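/- **Setting.** Let $r\ge 2$ be an integer, $X\subset\mathbb R^n$ open, $f:X\to\mathbb R^n$ and $H:X\to\mathbb R$ of class $C^r$ with $DH(x)f(x)=0$ on $X$, so that $H$ is a first integral of $\dot x=f(x)$. Let $g(x,t;T,\varepsilon)\in\mathbb R^n$ be defined for $x\in X$, $t\in\mathbb R$, $T>0$, $|\varepsilon|<\varepsilon_{\max}$, be $T$-periodic in $t$, and be of class $C^{r-1}$ in $t$ and $C^r$ in the other arguments (that is: jointly $C^{r-1}$, and $C^r$ in $(x,T,\varepsilon)$ with derivatives in $(x,T,\varepsilon)$ up to order $r$ continuous in all arguments). Let $x(t;\xi,T,\varepsilon)$ be the solution of $\dot x=f(x)+\varepsilon g(x,t;T,\varepsilon)$ in $X$ with value $\xi$ at $t=0$, and $x_0(t;\xi)=x(t;\xi,T,0)$. Let $m,l\ge1$ be relatively prime integers and let $\mathcal Z\subset X$ be a nonconstant periodic orbit of $\dot x=f(x)$ of minimal period $\tau>0$; fix $p\in\mathcal Z$ and suppose $DH(p)\neq0$. Let $\Pi=Y(\tau)$ be the monodromy matrix, where $\dot Y=Df(x_0(t;p))Y$, $Y(0)=I$.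 Suppose that $\mathcal Z$ is $m$-normal: either $\dim\ker(\Pi^m-I)=1$, or $\dim\ker(\Pi^m-I)=2$ and $f(p)\notin\operatorname{range}(\Pi^m-I)$. Let $L(\xi,\theta)$ be a scalar function that is $C^r$ near $\mathcal Z\times\{m\tau\}$, put $\lambda_0=L(p,m\tau)$, and suppose that $L$ parametrises a family of periodic orbits through $\mathcal Z$: for $\lambda$ near $\lambda_0$ there are periodic orbits of $\dot x=f(x)$ in $X$ through points $\vartheta(\lambda)$, of minimal period $\mathcal T(\lambda)$, with $\vartheta,\mathcal T$ of class $C^1$ near $\lambda_0$, $\vartheta(\lambda_0)=p$, $\mathcal T(\lambda_0)=\tau$, and $L\big(x_0(t;\vartheta(\lambda)),m\mathcal T(\lambda)\big)=\lambda$ for all $t$. The constrained displacement map is $$\Delta_{l,L}(\xi,T,\varepsilon)=\big(x(lT;\xi,T,\varepsilon)-\xi,\ L(\xi,lT)-\lambda_0\big),$$ and the Melnikov function, which does not involve $L$, is $$M^{m:l}(s)=\int_0^{m\tau}\big\langle DH(x_0(t+s;p)),\,g(x_0(t+s;p),t;\tau m/l,0)\big\rangle\,dt .$$ **Theorem (reduction).**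 For every such $L$ there are $\varepsilon_1\in(0,\varepsilon_{\max}]$, a constant $C_0$, and functions $B=B^{m:l}_L(s,\varepsilon)\in\mathbb R$, $\Xi(s,\varepsilon)\in\mathbb R^n$, $\Theta(s,\varepsilon)\in\mathbb R$, of class $C^{r-1}$ on $\mathbb R\times(-\varepsilon_1,\varepsilon_1)$ and $\tau$-periodic in $s$, such that for all $s\in\mathbb R$ and $|\varepsilon|<\varepsilon_1$ $$|B(s,\varepsilon)-M^{m:l}(s)|\le C_0|\varepsilon|,\qquad \|\Xi(s,\varepsilon)-x_0(s;p)\|\le C_0|\varepsilon|,\qquad |\Theta(s,\varepsilon)-\tau m/l|\le C_0|\varepsilon| ,$$ and such that the solutions of $\Delta_{l,L}=0$ that are $O(\varepsilon)$-close to $\mathcal Z$ are in one-to-one correspondence with the zeros of $B$: for every $C\ge C_0$ there is $\varepsilon_0\in(0,\varepsilon_1]$ such that, whenever $0<|\varepsilon|<\varepsilon_0$, the map $s\mapsto(\Xi(s,\varepsilon),\Theta(s,\varepsilon))$ is a bijection from $\{s\in[0,\tau): B(s,\varepsilon)=0\}$ onto the set of $(\xi,T)$ with $T>0$ for which $x(\cdot;\xi,T,\varepsilon)$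 exists on $[0,lT]$, $\Delta_{l,L}(\xi,T,\varepsilon)=0$, $\|\xi-x_0(s';p)\|\le C|\varepsilon|$ for some $s'\in\mathbb R$, and $|T-\tau m/l|\le C|\varepsilon|$. In particular $B^{m:l}_L(s,\varepsilon)=M^{m:l}(s)+O(\varepsilon)$, and the leading term does not depend on $L$. -/

import Mathlib

/-- Phase space `ℝⁿ` with its Euclidean norm. -/
abbrev Phase (n : ℕ) : Type := EuclideanSpace ℝ (Fin n)

/-- Regularity and periodicity of the perturbation `g x t T ε`, for `x` in the open set `X`,
`t ∈ ℝ`, `T > 0` and `|ε| < εmax`: it is `T`-periodic in `t`, of class `C^(r-1)` in all its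
arguments, and of class `C^r` in `(x, T, ε)`, with derivatives in `(x, T, ε)` that are continuous
in all the arguments (those of order below `r` are so by joint `C^(r-1)` regularity). -/
structure IsPerturbation {n : ℕ} (X : Set (Phase n)) (εmax : ℝ) (r : ℕ)
    (g : Phase n → ℝ → ℝ → ℝ → Phase n) : Prop where
  periodic : ∀ x ∈ X, ∀ t T ε : ℝ, 0 < T → |ε| < εmax → g x (t + T) T ε = g x t T ε
  contDiffOn_joint :
    ContDiffOn ℝ ((r - 1 : ℕ) : WithTop ℕ∞)
      (fun q : (Phase n × ℝ × ℝ) × ℝ => g q.1.1 q.2 q.1.2.1 q.1.2.2)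
      ((X ×ˢ Set.Ioi (0 : ℝ) ×ˢ Set.Ioo (-εmax) εmax) ×ˢ Set.univ)
  contDiffOn_slice : ∀ t : ℝ,
    ContDiffOn ℝ (r : WithTop ℕ∞)
      (fun w : Phase n × ℝ × ℝ => g w.1 t w.2.1 w.2.2)
      (X ×ˢ Set.Ioi (0 : ℝ) ×ˢ Set.Ioo (-εmax) εmax)
  continuousOn_top :
    ContinuousOn
      (fun q : (Phase n × ℝ × ℝ) × ℝ =>
        iteratedFDeriv ℝ r (fun w : Phase n × ℝ × ℝ => g w.1 q.2 w.2.1 w.2.2) q.1)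
      ((X ×ˢ Set.Ioi (0 : ℝ) ×ˢ Set.Ioo (-εmax) εmax) ×ˢ Set.univ)

/-- `x` solves `x' = f x + ε g(x, t; T, ε)` on `[0, b]` inside `X`, with `x 0 = ξ`. -/
def IsTrajectory {n : ℕ} (X : Set (Phase n)) (f : Phase n → Phase n)
    (g : Phase n → ℝ → ℝ → ℝ → Phase n) (ξ : Phase n) (T ε b : ℝ) (x : ℝ → Phase n) : Prop :=
  x 0 = ξ ∧ ∀ t ∈ Set.Icc (0 : ℝ) b,
    x t ∈ X ∧ HasDerivWithinAt x (f (x t) + ε • g (x t) t T ε) (Set.Icc (0 : ℝ) b) t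

open Classical in
/-- The point `x(t; ξ, T, ε)` for `t ≥ 0`. It is meaningful when the trajectory exists on `[0, t]`
(it is then unique, the vector field being locally Lipschitz in `x`); it is `0` otherwise. -/
noncomputable def trajectory {n : ℕ} (X : Set (Phase n)) (f : Phase n → Phase n)
    (g : Phase n → ℝ → ℝ → ℝ → Phase n) (t : ℝ) (ξ : Phase n) (T ε : ℝ) : Phase n :=
  if h : ∃ x : ℝ → Phase n, IsTrajectory X f g ξ T ε t x then h.choose t else 0

/-- The pairs `(ξ, T)` for which the displacement map `Δ_l` is defined at `ε`. -/
def displacementDomain {n : ℕ} (X : Set (Phase n)) (f : Phase n → Phase n)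
    (g : Phase n → ℝ → ℝ → ℝ → Phase n) (l : ℕ) (ε : ℝ) : Set (Phase n × ℝ) :=
  {y | 0 < y.2 ∧ ∃ x : ℝ → Phase n, IsTrajectory X f g y.1 y.2 ε (l * y.2) x}

/-- The displacement map `Δ_l(ξ, T, ε) = x(lT; ξ, T, ε) - ξ`. -/
noncomputable def displacement {n : ℕ} (X : Set (Phase n)) (f : Phase n → Phase n)
    (g : Phase n → ℝ → ℝ → ℝ → Phase n) (l : ℕ) (ξ : Phase n) (T ε : ℝ) : Phase n :=
  trajectory X f g (l * T) ξ T ε - ξ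

/-- The constrained displacement map `Δ_{l,L}(ξ, T, ε) = (Δ_l(ξ, T, ε), L(ξ, lT) - lam)`. -/
noncomputable def constrainedDisplacement {n : ℕ} (X : Set (Phase n)) (f : Phase n → Phase n)
    (g : Phase n → ℝ → ℝ → ℝ → Phase n) (l : ℕ) (L : Phase n × ℝ → ℝ) (lam : ℝ)
    (ξ : Phase n) (T ε : ℝ) : Phase n × ℝ :=
  (displacement X f g l ξ T ε, L (ξ, l * T) - lam)

/-- `γ` runs along a periodic orbit in `X` of `x' = f x`, of minimal period `τ > 0`. -/
structure IsPeriodicOrbit {n : ℕ} (X : Set (Phase n)) (f : Phase n → Phase n)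
    (γ : ℝ → Phase n) (τ : ℝ) : Prop where
  period_pos : 0 < τ
  mem : ∀ t, γ t ∈ X
  hasDerivAt : ∀ t, HasDerivAt γ (f (γ t)) t
  periodic : ∀ t, γ (t + τ) = γ t
  minimal : ∀ t, 0 < t → t < τ → γ t ≠ γ 0

/-- `Y` solves the equation of variations `Y' = Df(γ t) Y`, `Y 0 = I`, along `γ`. -/
def IsVariationalSolution {n : ℕ} (f : Phase n → Phase n) (γ : ℝ → Phase n)
    (Y : ℝ → (Phase n →L[ℝ] Phase n)) : Prop :=
  Y 0 = 1 ∧ ∀ t, HasDerivAt Y ((fderiv ℝ f (γ t)).comp (Y t)) t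

/-- The periodic orbit `γ` of period `τ` is `m`-normal. With the monodromy matrix `Π = Y τ` at
`p = γ 0`: either `Π ^ m - I` has a one-dimensional kernel, or it has a two-dimensional kernel and
`f p` is not in its range. -/
def IsMNormal {n : ℕ} (f : Phase n → Phase n) (γ : ℝ → Phase n) (τ : ℝ) (m : ℕ) : Prop :=
  ∃ Y : ℝ → (Phase n →L[ℝ] Phase n), IsVariationalSolution f γ Y ∧
    (Module.finrank ℝ (LinearMap.ker ((Y τ ^ m - 1 : Phase n →L[ℝ] Phase n) :
        Phase n →ₗ[ℝ] Phase n)) = 1 ∨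
      (Module.finrank ℝ (LinearMap.ker ((Y τ ^ m - 1 : Phase n →L[ℝ] Phase n) :
          Phase n →ₗ[ℝ] Phase n)) = 2 ∧
        f (γ 0) ∉ LinearMap.range ((Y τ ^ m - 1 : Phase n →L[ℝ] Phase n) :
          Phase n →ₗ[ℝ] Phase n)))

/-- `L` parametrises, near the orbit `γ` of minimal period `τ`, a one-parameter family of periodic
orbits through it. The orbit with parameter `lam` is `u lam` and its minimal period is `P lam`; its
initial point and its period are `C¹` in `lam`; and `L(u lam t, m P lam) = lam` for all `t`. -/
def ParametrisesFamily {n : ℕ} (X : Set (Phase n)) (f : Phase n → Phase n) (γ : ℝ → Phase n)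
    (τ : ℝ) (m : ℕ) (L : Phase n × ℝ → ℝ) : Prop :=
  ∃ (u : ℝ → ℝ → Phase n) (P : ℝ → ℝ),
    u (L (γ 0, m * τ)) = γ ∧ P (L (γ 0, m * τ)) = τ ∧
    ContDiffAt ℝ 1 (fun lam => u lam 0) (L (γ 0, m * τ)) ∧
    ContDiffAt ℝ 1 P (L (γ 0, m * τ)) ∧
    ∀ᶠ lam in nhds (L (γ 0, m * τ)),
      IsPeriodicOrbit X f (u lam) (P lam) ∧ ∀ t, L (u lam t, m * P lam) = lam

/-- The Melnikov function
`M^{m:l}(s) = ∫_0^{mτ} ⟨DH(x₀(t+s; p)), g(x₀(t+s; p), t; τm/l, 0)⟩ dt`, where `x₀(t; p) = γ t`. -/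
noncomputable def melnikov {n : ℕ} (H : Phase n → ℝ) (g : Phase n → ℝ → ℝ → ℝ → Phase n)
    (γ : ℝ → Phase n) (τ : ℝ) (m l : ℕ) (s : ℝ) : ℝ :=
  ∫ t in (0 : ℝ)..(m * τ), fderiv ℝ H (γ (t + s)) (g (γ (t + s)) t (τ * m / l) 0)

/-- The solutions `(ξ, T)` at `ε` of the constrained problem `Δ_{l,L} = 0`, with `lam = L(p, mτ)`,
for which `ξ` is `C|ε|`-close to some `x₀(s; p)` and `T` is `C|ε|`-close to `τm/l`. -/
def closeSolutions {n : ℕ} (X : Set (Phase n)) (f : Phase n → Phase n)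
    (g : Phase n → ℝ → ℝ → ℝ → Phase n) (γ : ℝ → Phase n) (τ : ℝ) (m l : ℕ)
    (L : Phase n × ℝ → ℝ) (C ε : ℝ) : Set (Phase n × ℝ) :=
  {y | y ∈ displacementDomain X f g l ε ∧
    constrainedDisplacement X f g l L (L (γ 0, m * τ)) y.1 y.2 ε = 0 ∧
    (∃ s : ℝ, ‖y.1 - γ s‖ ≤ C * |ε|) ∧ |y.2 - τ * m / l| ≤ C * |ε|}

-- The equation `Δ_{l,L} = 0` is degenerate at ε = 0 in two ways: every point of the orbit solves
-- it, and, H being conserved, the linearised displacement has no component that DH can see. The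
-- augmented problem removes both defects. A parameter s and the phase condition ⟨ξ - γ s, f(γ s)⟩ =
-- 0 select a point of the orbit, and a multiplier μ, entering through -μ ∇H(γ s), supplies the
-- missing direction. The unknowns become (ξ, T, μ), with solution (γ s, τm/l, 0) at ε = 0.
--
-- The linearisation there is injective (`partial_injective`). Applying DH leaves only μ, so μ = 0.
-- What remains is the kernel of (η, c) ↦ (Π^m - I)η + c f(p), which by m-normality is spanned by
-- (f(p), 0) and the tangent of the family of periodic orbits. The constraint L excludes the tangent
-- and the phase condition excludes f. An implicit function theorem, uniform along the orbit
-- (`exists_periodic_implicitFunction`), then gives Ψ(s, ε) = (Ξ, Θ, μ).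
--
-- Genuine solutions are those with μ = 0. Instead of dividing μ by ε, which would cost a
-- derivative, use the balance H(x(lT)) - H(ξ) = ε · work (`H_trajectory`). On Ψ the end point is ξ
-- + μ∇H(γ s), and H takes its value at ξ only once on a short segment along the gradient
-- (`eventually_H_add_gradient`), so for ε ≠ 0 one has μ = 0 exactly when the work vanishes. Hence B
-- is the work along Ψ: it is as smooth as the flow, and at ε = 0 it is the Melnikov integral,
-- whatever L is. A solution close to the orbit is assigned the s of its nearest orbit point, unique
-- modulo τ by `exists_foot_unique`.
--
-- Smooth dependence of end point and work on (ξ, T, ε) comes from the implicit function theorem in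
-- C([0,1], E), applied to the integral equation, whose linearisation is the identity minus a
-- Volterra operator.

universe u

section Auxiliary

open Set Filter Topology MeasureTheory
open scoped unitInterval Manifold ContDiff

/-! ### Superposition operators on spaces of continuous functions -/

section Nemytskii

variable {α : Type*} [TopologicalSpace α] [CompactSpace α]

/-- Pointwise application of a continuous family of operators to a continuous function. -/
noncomputable def ContinuousMap.pointwiseApply (E F : Type*) [NormedAddCommGroup E]
    [NormedSpace ℝ E] [NormedAddCommGroup F] [NormedSpace ℝ F] :
    C(α, E →L[ℝ] F) →L[ℝ] C(α, E) →L[ℝ] C(α, F) :=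
  LinearMap.mkContinuous₂
    (LinearMap.mk₂ ℝ (fun (a : C(α, E →L[ℝ] F)) (z : C(α, E)) =>
        (⟨fun t => a t (z t), by fun_prop⟩ : C(α, F)))
      (fun _ _ _ => by ext; simp) (fun _ _ _ => by ext; simp)
      (fun _ _ _ => by ext; simp) (fun _ _ _ => by ext; simp)) 1
    (fun a z => by
      rw [ContinuousMap.norm_le _ (by positivity)]
      intro t
      simp only [LinearMap.mk₂_apply, ContinuousMap.coe_mk, one_mul]
      exact (ContinuousLinearMap.le_opNorm _ _).trans
        (mul_le_mul (a.norm_coe_le_norm t) (z.norm_coe_le_norm t) (norm_nonneg _)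
          (norm_nonneg a)))

@[simp]
theorem ContinuousMap.pointwiseApply_apply {E F : Type*} [NormedAddCommGroup E]
    [NormedSpace ℝ E] [NormedAddCommGroup F] [NormedSpace ℝ F] (a : C(α, E →L[ℝ] F))
    (z : C(α, E)) (t : α) : ContinuousMap.pointwiseApply E F a z t = a t (z t) := rfl

/-- The mean value inequality at each t needs V' to be nearly constant on a ball about z t whose
radius does not depend on t. This follows from continuity of w ↦ V' ∘ w in the sup norm. -/
theorem hasFDerivAt_comp_continuousMap {E F : Type*} [NormedAddCommGroup E]
    [NormedSpace ℝ E] [NormedAddCommGroup F] [NormedSpace ℝ F] (V : C(E, F)) (V' : C(E, E →L[ℝ] F))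
    (hV : ∀ x, HasFDerivAt V (V' x) x) (z : C(α, E)) :
    HasFDerivAt (fun z : C(α, E) => V.comp z)
      (ContinuousMap.pointwiseApply E F (V'.comp z)) z := by
  rw [hasFDerivAt_iff_isLittleO, Asymptotics.isLittleO_iff]
  intro c hc
  have hcont : Tendsto (fun w : C(α, E) => V'.comp w) (𝓝 z) (𝓝 (V'.comp z)) :=
    (ContinuousMap.continuous_postcomp V').tendsto z
  obtain ⟨δ, hδ, hball⟩ :=
    (Metric.tendsto_nhds_nhds (f := fun w : C(α, E) => V'.comp w)).1 hcont c hc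
  filter_upwards [Metric.ball_mem_nhds z hδ] with w hw
  rw [ContinuousMap.norm_le _ (by positivity)]
  intro t
  have hwt : w t ∈ Metric.ball (z t) δ := (ContinuousMap.dist_apply_le_dist t).trans_lt hw
  have key := (convex_ball (z t) δ).norm_image_sub_le_of_norm_hasFDerivWithin_le'
    (f := V) (f' := V') (φ := V' (z t)) (C := c) (x := z t) (y := w t)
    (fun y _ => (hV y).hasFDerivWithinAt) ?_ (Metric.mem_ball_self hδ) hwt
  · refine key.trans ?_
    gcongr
    exact (w - z).norm_coe_le_norm t
  · intro y hy
    -- Translating all of z by the constant y - z t gives a function close to z whose value at t is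
    -- y.
    have h1 : dist (z + ContinuousMap.const α (y - z t)) z < δ := by
      rw [dist_eq_norm, add_sub_cancel_left, ContinuousMap.norm_lt_iff _ hδ]
      intro _
      simpa [dist_eq_norm] using hy
    have h2 := (ContinuousMap.dist_apply_le_dist t).trans_lt (hball h1)
    simpa [dist_eq_norm] using h2.le

/-- The derivative is pointwise application of V' ∘ z, that is, a continuous linear map after the
superposition operator of V', which is one degree less smooth. -/
theorem contDiff_comp_continuousMap {E F : Type u} [NormedAddCommGroup E]
    [NormedSpace ℝ E] [NormedAddCommGroup F] [NormedSpace ℝ F] (n : ℕ) (V : C(E, F))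
    (hV : ContDiff ℝ n V) : ContDiff ℝ n (fun z : C(α, E) => V.comp z) := by
  induction n generalizing F with
  | zero =>
    exact contDiff_zero.2 (ContinuousMap.continuous_postcomp V)
  | succ n ih =>
    rw [Nat.cast_add, Nat.cast_one] at hV ⊢
    have hV' := contDiff_succ_iff_fderiv.1 hV
    let V' : C(E, E →L[ℝ] F) := ⟨fderiv ℝ V, hV'.2.2.continuous⟩
    refine contDiff_succ_iff_hasFDerivAt.2 ⟨_, ?_, fun z =>
      hasFDerivAt_comp_continuousMap V V' (fun x => (hV'.1 x).hasFDerivAt) z⟩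
    exact (ContinuousMap.pointwiseApply E F).contDiff.comp (ih V' hV'.2.2)

end Nemytskii

/-! ### Volterra operators on [0, 1] -/

section Volterra

section

variable {E : Type*} [NormedAddCommGroup E]

/-- A continuous function on `[0, 1]`, extended by constants to the line. -/
noncomputable def ContinuousMap.extendUnit (z : C(I, E)) (t : ℝ) : E :=
  IccExtend (zero_le_one' ℝ) z t

theorem ContinuousMap.continuous_extendUnit (z : C(I, E)) : Continuous z.extendUnit :=
  z.continuous.Icc_extend'

theorem ContinuousMap.extendUnit_of_mem (z : C(I, E)) {t : ℝ} (ht : t ∈ I) :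
    z.extendUnit t = z ⟨t, ht⟩ := IccExtend_of_mem _ _ ht

theorem ContinuousMap.norm_extendUnit_le (z : C(I, E)) (t : ℝ) : ‖z.extendUnit t‖ ≤ ‖z‖ :=
  z.norm_coe_le_norm _

end

variable {E : Type*} [NormedAddCommGroup E] [NormedSpace ℝ E]

/-- The primitive `t ↦ ∫₀ᵗ z` on `[0, 1]`. -/
noncomputable def ContinuousMap.primitive (E : Type*) [NormedAddCommGroup E] [NormedSpace ℝ E] :
    C(I, E) →L[ℝ] C(I, E) :=
  LinearMap.mkContinuous
    { toFun := fun z => ⟨fun t => ∫ s in (0 : ℝ)..t, z.extendUnit s,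
        (intervalIntegral.continuous_primitive
          (fun a b => z.continuous_extendUnit.intervalIntegrable a b) 0).comp
          continuous_subtype_val⟩
      map_add' := fun z w => by
        ext t
        exact intervalIntegral.integral_add (z.continuous_extendUnit.intervalIntegrable _ _)
          (w.continuous_extendUnit.intervalIntegrable _ _)
      map_smul' := fun c z => by
        ext t
        exact intervalIntegral.integral_smul c z.extendUnit } 1
    (fun z => by
      rw [ContinuousMap.norm_le _ (by positivity)]
      intro t
      have := intervalIntegral.norm_integral_le_of_norm_le_const (a := (0 : ℝ)) (b := t)
        (f := z.extendUnit) (C := ‖z‖) (fun s _ => z.norm_extendUnit_le s)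
      refine this.trans ?_
      rw [sub_zero, abs_of_nonneg t.2.1, mul_comm]
      exact mul_le_mul_of_nonneg_right t.2.2 (norm_nonneg z))

theorem ContinuousMap.primitive_apply (z : C(I, E)) (t : I) :
    ContinuousMap.primitive E z t = ∫ s in (0 : ℝ)..t, z.extendUnit s := rfl

theorem ContinuousMap.hasDerivAt_integral_extendUnit [CompleteSpace E] (z : C(I, E)) {t : ℝ} :
    HasDerivAt (fun t : ℝ => ∫ s in (0 : ℝ)..t, z.extendUnit s) (z.extendUnit t) t :=
  intervalIntegral.integral_hasDerivAt_right (z.continuous_extendUnit.intervalIntegrable _ _)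
    (z.continuous_extendUnit.stronglyMeasurableAtFilter _ _) z.continuous_extendUnit.continuousAt

/-- The Volterra operator `z ↦ ∫₀ᵗ a(s) z(s) ds`. -/
noncomputable def volterra (a : C(I, E →L[ℝ] E)) : C(I, E) →L[ℝ] C(I, E) :=
  (ContinuousMap.primitive E).comp (ContinuousMap.pointwiseApply E E a)

/-- Each further integration turns tⁿ/n! into tⁿ⁺¹/(n+1)!; keeping the dependence on t in the bound
is what makes the induction produce the factorial. -/
theorem norm_volterra_pow_apply_le (a : C(I, E →L[ℝ] E)) (n : ℕ) (z : C(I, E)) (t : I) :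
    ‖(volterra a ^ n) z t‖ ≤ ‖a‖ ^ n * (t : ℝ) ^ n / n.factorial * ‖z‖ := by
  induction n generalizing t with
  | zero => simpa using z.norm_coe_le_norm t
  | succ n ih =>
    have h0 : ∀ s ∈ Ioc (0 : ℝ) t,
        ‖(ContinuousMap.pointwiseApply E E a ((volterra a ^ n) z)).extendUnit s‖ ≤
          ‖a‖ * (‖a‖ ^ n * s ^ n / n.factorial * ‖z‖) := by
      intro s hs
      have hsI : s ∈ I := ⟨hs.1.le, hs.2.trans t.2.2⟩
      rw [ContinuousMap.extendUnit_of_mem _ hsI, ContinuousMap.pointwiseApply_apply]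
      refine (ContinuousLinearMap.le_opNorm _ _).trans ?_
      exact mul_le_mul (a.norm_coe_le_norm _) (ih ⟨s, hsI⟩) (norm_nonneg _) (norm_nonneg a)
    have h1 : (volterra a ^ (n + 1)) z t = ∫ s in (0 : ℝ)..t,
        (ContinuousMap.pointwiseApply E E a ((volterra a ^ n) z)).extendUnit s := by
      rw [pow_succ']
      rfl
    rw [h1]
    refine (intervalIntegral.norm_integral_le_of_norm_le t.2.1
      (Eventually.of_forall fun s => h0 s) (by
        apply Continuous.intervalIntegrable; fun_prop)).trans (le_of_eq ?_)
    have h2 : ∀ s : ℝ, ‖a‖ * (‖a‖ ^ n * s ^ n / n.factorial * ‖z‖) =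
        (‖a‖ ^ (n + 1) / n.factorial * ‖z‖) * s ^ n := fun s => by ring
    simp_rw [h2]
    rw [intervalIntegral.integral_const_mul, integral_pow, Nat.factorial_succ]
    push_cast
    have : (n.factorial : ℝ) ≠ 0 := by positivity
    have : ((n : ℝ) + 1) ≠ 0 := by positivity
    field_simp
    simp

/-- Some power of the operator has norm below 1, so 1 - aⁿ is invertible; it is the product of 1 - a
and a geometric sum commuting with it. No smallness of the kernel is needed. -/
theorem isUnit_one_sub_volterra [CompleteSpace E] (a : C(I, E →L[ℝ] E)) :
    IsUnit (1 - volterra a) := by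
  obtain ⟨n, hn⟩ := ((FloorSemiring.tendsto_pow_div_factorial_atTop ‖a‖).eventually_lt_const
    (zero_lt_one' ℝ)).exists
  have h1 : ‖volterra a ^ n‖ < 1 := by
    refine lt_of_le_of_lt (ContinuousLinearMap.opNorm_le_bound _ (by positivity) fun z => ?_) hn
    rw [ContinuousMap.norm_le _ (by positivity)]
    intro t
    refine (norm_volterra_pow_apply_le a n z t).trans ?_
    gcongr
    exact mul_le_of_le_one_right (by positivity) (pow_le_one₀ t.2.1 t.2.2)
  have h2 : IsUnit (1 - volterra a ^ n) :=
    isUnit_one_sub_of_norm_lt_one (R := C(I, E) →L[ℝ] C(I, E)) h1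
  rw [← mul_neg_geom_sum] at h2
  have h3 : Commute (1 - volterra a) (∑ i ∈ Finset.range n, volterra a ^ i) := by
    rw [Commute, SemiconjBy, mul_neg_geom_sum, geom_sum_mul_neg]
  exact (h3.isUnit_mul_iff.1 h2).1

end Volterra

/-! ### Smooth dependence of solutions near a given curve -/

section Flow

theorem ContinuousMap.eq_const_add_primitive {E : Type*} [NormedAddCommGroup E] [NormedSpace ℝ E]
    [CompleteSpace E] {x : ℝ → E} {u ζ : C(I, E)}
    (hx : ∀ t ∈ I, HasDerivWithinAt x (u.extendUnit t) I t) (hζ : ∀ t : I, ζ t = x t) :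
    ζ = ContinuousMap.const I (x 0) + ContinuousMap.primitive E u := by
  ext t
  have hsub : Icc (0 : ℝ) t ⊆ I := Icc_subset_Icc_right t.2.2
  have := intervalIntegral.integral_eq_sub_of_hasDerivAt_of_le (f := x) (f' := u.extendUnit)
    t.2.1 (fun s hs => ((hx s (hsub hs)).mono hsub).continuousWithinAt)
    (fun s hs => (hx s (hsub (Ioo_subset_Icc_self hs))).hasDerivAt
      (Icc_mem_nhds hs.1 (hs.2.trans_le t.2.2)))
    (u.continuous_extendUnit.intervalIntegrable _ _)
  rw [ContinuousMap.add_apply, ContinuousMap.primitive_apply, this, hζ]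
  simp

theorem ContinuousMap.hasDerivWithinAt_of_eq {E : Type*} [NormedAddCommGroup E] [NormedSpace ℝ E]
    [CompleteSpace E] {u ζ : C(I, E)} {w : E}
    (h : ζ = ContinuousMap.const I w + ContinuousMap.primitive E u) :
    ζ.extendUnit 0 = w ∧ ∀ t ∈ I, HasDerivWithinAt ζ.extendUnit (u.extendUnit t) I t := by
  have key : ∀ t ∈ I, ζ.extendUnit t = w + ∫ s in (0 : ℝ)..t, u.extendUnit s := by
    intro t ht
    rw [ζ.extendUnit_of_mem ht, h]
    rfl
  refine ⟨by simpa using key 0 ⟨le_rfl, zero_le_one⟩, fun t ht => ?_⟩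
  exact (u.hasDerivAt_integral_extendUnit.hasDerivWithinAt.const_add w).congr key (key t ht)

/-- Local smooth dependence of the solutions on `[0, 1]` on the initial value, in integral form. -/
theorem exists_contDiffAt_solutionMap {E : Type u} [NormedAddCommGroup E] [NormedSpace ℝ E]
    [CompleteSpace E] {k : ℕ} (hk : k ≠ 0) (V : C(E, E)) (V' : C(E, E →L[ℝ] E))
    (hV : ContDiff ℝ k V) (hV' : ∀ x, HasFDerivAt V (V' x) x) (w₀ : E) (z : C(I, E))
    (hz : z = ContinuousMap.const I w₀ + ContinuousMap.primitive E (V.comp z)) :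
    ∃ Z : E → C(I, E), ContDiffAt ℝ k Z w₀ ∧ Z w₀ = z ∧
      (∀ᶠ w in 𝓝 w₀, Z w = ContinuousMap.const I w + ContinuousMap.primitive E (V.comp (Z w))) ∧
      ∀ η, (1 - volterra (V'.comp z)) (fderiv ℝ Z w₀ η) = ContinuousMap.const I η := by
  let c : E →L[ℝ] C(I, E) := ContinuousLinearMap.const ℝ I
  let G : E × C(I, E) → C(I, E) := fun q =>
    q.2 - c q.1 - ContinuousMap.primitive E (V.comp q.2)
  have hG : ContDiff ℝ k G := by
    have h1 := (contDiff_comp_continuousMap (α := I) k V hV).comp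
      (contDiff_snd (E := E) (F := C(I, E)))
    exact (contDiff_snd.sub (c.contDiff.comp contDiff_fst)).sub
      ((ContinuousMap.primitive E).contDiff.comp h1)
  have hG' : HasFDerivAt G (ContinuousLinearMap.snd ℝ E C(I, E) -
      c.comp (ContinuousLinearMap.fst ℝ E C(I, E)) -
      (volterra (V'.comp z)).comp (ContinuousLinearMap.snd ℝ E C(I, E))) (w₀, z) := by
    have h1 := (hasFDerivAt_comp_continuousMap V V' hV' z).comp (w₀, z)
      (hasFDerivAt_snd (𝕜 := ℝ) (E := E) (F := C(I, E)))
    exact ((hasFDerivAt_snd.sub (c.hasFDerivAt.comp _ hasFDerivAt_fst)).sub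
      ((ContinuousMap.primitive E).hasFDerivAt.comp _ h1))
  have hG0 : G (w₀, z) = 0 := by
    have : G (w₀, z) = z - (ContinuousMap.const I w₀ + ContinuousMap.primitive E (V.comp z)) :=
      sub_sub _ _ _
    rw [this, ← hz, sub_self]
  -- The partial derivative of G in the curve is the identity minus a Volterra operator.
  have hinv : (fderiv ℝ G (w₀, z) ∘L .inr ℝ E C(I, E)).IsInvertible := by
    obtain ⟨e, he⟩ := isUnit_one_sub_volterra (V'.comp z)
    refine ⟨ContinuousLinearEquiv.unitsEquiv ℝ _ e, ?_⟩
    rw [hG'.fderiv]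
    ext ζ : 1
    simp [he]
  have hk' : ((k : ℕ) : WithTop ℕ∞) ≠ 0 := by exact_mod_cast hk
  have hGat := hG.contDiffAt (x := (w₀, z))
  let Z := hGat.implicitFunction hk' hinv
  have hZ0 : Z w₀ = z := hGat.implicitFunction_apply_self hk' hinv
  have hZc : ContDiffAt ℝ k Z w₀ := hGat.contDiffAt_implicitFunction hk' hinv
  have hZev : ∀ᶠ w in 𝓝 w₀, G (w, Z w) = 0 := by
    rw [← hG0]
    exact hGat.eventually_apply_implicitFunction hk' hinv
  refine ⟨Z, hZc, hZ0, ?_, fun η => ?_⟩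
  · filter_upwards [hZev] with w hw
    rw [← sub_eq_zero, ← sub_sub]
    exact hw
  -- Differentiating G(w, Z w) = 0 at w₀ gives the equation of variations in integral form.
  · have h1 : HasFDerivAt Z (fderiv ℝ Z w₀) w₀ := (hZc.differentiableAt hk').hasFDerivAt
    rw [← hZ0] at hG'
    have h2 := hG'.comp w₀ ((hasFDerivAt_id w₀).prodMk h1)
    have h3 : HasFDerivAt (G ∘ fun w => (id w, Z w)) (0 : E →L[ℝ] C(I, E)) w₀ :=
      (hasFDerivAt_const 0 w₀).congr_of_eventuallyEq hZev
    have h4 := DFunLike.congr_fun (h2.unique h3) η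
    rw [hZ0] at h4
    simp only [ContinuousLinearMap.comp_apply, sub_apply,
      ContinuousLinearMap.prod_apply, ContinuousLinearMap.coe_fst', ContinuousLinearMap.coe_snd',
      zero_apply, ContinuousLinearMap.id_apply] at h4
    have h5 : (1 - volterra (V'.comp z)) (fderiv ℝ Z w₀ η) = fderiv ℝ Z w₀ η -
      volterra (V'.comp z) (fderiv ℝ Z w₀ η) := rfl
    rw [h5, ← sub_eq_zero, sub_right_comm]
    exact h4

/-- A `C^k` map on an open set agrees near a compact subset with a compactly supported
`C^k` map. -/
theorem exists_contDiff_hasCompactSupport_eq_nhdsSet {E F : Type*} [NormedAddCommGroup E]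
    [NormedSpace ℝ E] [FiniteDimensional ℝ E] [NormedAddCommGroup F] [NormedSpace ℝ F] {k : ℕ}
    {U K : Set E} (hU : IsOpen U) (hK : IsCompact K) (hKU : K ⊆ U) {V : E → F}
    (hV : ContDiffOn ℝ k V U) :
    ∃ W : E → F, ContDiff ℝ k W ∧ HasCompactSupport W ∧ ∀ᶠ x in 𝓝ˢ K, W x = V x := by
  obtain ⟨L, hL, hKL, hLU⟩ := exists_compact_between hK hU hKU
  obtain ⟨χ, h1, h0, -⟩ := exists_contMDiffMap_one_nhds_of_subset_interior (n := (k : ℕ∞))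
    𝓘(ℝ, E) hK.isClosed hKL
  have hχ : ContDiff ℝ k χ := χ.contMDiff.contDiff
  refine ⟨fun x => χ x • V x, ?_, ?_, ?_⟩
  · rw [contDiff_iff_contDiffAt]
    intro x
    by_cases hx : x ∈ L
    · exact hχ.contDiffAt.smul (hV.contDiffAt (hU.mem_nhds (hLU hx)))
    · refine (contDiffAt_const (c := (0 : F))).congr_of_eventuallyEq ?_
      filter_upwards [hL.isClosed.isOpen_compl.mem_nhds hx] with y hy
      rw [h0 y hy, zero_smul]
  · exact HasCompactSupport.intro hL fun x hx => by rw [h0 x hx, zero_smul]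
  · filter_upwards [h1] with x hx
    rw [hx, one_smul]

/-- Smooth dependence on initial values near a given integral curve on `[0, 1]`; the derivative of
the time-one map is given by the equation of variations. -/
theorem exists_flow_near_curve {E : Type u} [NormedAddCommGroup E] [NormedSpace ℝ E]
    [FiniteDimensional ℝ E] {k : ℕ} (hk : k ≠ 0) {U : Set E} (hU : IsOpen U) {V : E → E}
    (hV : ContDiffOn ℝ k V U) {z : ℝ → E}
    (hz : ∀ t ∈ I, z t ∈ U ∧ HasDerivWithinAt z (V (z t)) I t) :
    ∃ Φ : E → ℝ → E, ContDiffAt ℝ k (fun w => Φ w 1) (z 0) ∧ EqOn (Φ (z 0)) z I ∧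
      (∀ᶠ w in 𝓝 (z 0), Φ w 0 = w ∧
        ∀ t ∈ I, Φ w t ∈ U ∧ HasDerivWithinAt (Φ w) (V (Φ w t)) I t) ∧
      ∀ v : ℝ → E, (∀ t ∈ I, HasDerivWithinAt v (fderiv ℝ V (z t) (v t)) I t) →
        fderiv ℝ (fun w => Φ w 1) (z 0) (v 0) = v 1 := by
  have : CompleteSpace E := FiniteDimensional.complete ℝ E
  have hk' : ((k : ℕ) : WithTop ℕ∞) ≠ 0 := by exact_mod_cast hk
  have hzc : ContinuousOn z I := fun t ht => (hz t ht).2.continuousWithinAt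
  -- Superposition requires a field defined on all of E, so V is cut off near the compact image of
  -- the curve.
  obtain ⟨W, hW, -, hWV⟩ := exists_contDiff_hasCompactSupport_eq_nhdsSet hU
    (isCompact_Icc.image_of_continuousOn hzc) (image_subset_iff.2 fun t ht => (hz t ht).1) hV
  rw [eventually_nhdsSet_iff_exists] at hWV
  obtain ⟨O, hO, hzO, hOV⟩ := hWV
  have hzO' : ∀ t ∈ I, z t ∈ O := fun t ht => hzO (mem_image_of_mem z ht)
  let Wc : C(E, E) := ⟨W, hW.continuous⟩
  let Wc' : C(E, E →L[ℝ] E) := ⟨fderiv ℝ W, hW.continuous_fderiv hk'⟩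
  let zc : C(I, E) := ⟨fun t => z t, hzc.domRestrict⟩
  have hWcz : ∀ t (ht : t ∈ I) (ζ : C(I, E)), (Wc.comp ζ).extendUnit t = W (ζ ⟨t, ht⟩) :=
    fun t ht ζ => (Wc.comp ζ).extendUnit_of_mem ht
  have hzeq : zc = ContinuousMap.const I (z 0) + ContinuousMap.primitive E (Wc.comp zc) := by
    refine ContinuousMap.eq_const_add_primitive (fun t ht => ?_) fun t => rfl
    rw [hWcz t ht]
    have := (hz t ht).2
    rwa [← hOV _ (hzO' t ht)] at this
  obtain ⟨Z, hZc, hZ0, hZev, hZd⟩ := exists_contDiffAt_solutionMap hk Wc Wc' hW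
    (fun x => (hW.differentiable hk' x).hasFDerivAt) (z 0) zc hzeq
  let ev : C(I, E) →L[ℝ] E := ContinuousMap.evalCLM ℝ (1 : I)
  have hev : (fun w => (Z w).extendUnit 1) = fun w => ev (Z w) := by
    ext w
    exact (Z w).extendUnit_of_mem ⟨zero_le_one, le_rfl⟩
  refine ⟨fun w => (Z w).extendUnit, ?_, ?_, ?_, ?_⟩
  · rw [hev]
    exact ev.contDiff.contDiffAt.comp _ hZc
  · intro t ht
    simp only [hZ0, zc.extendUnit_of_mem ht]
    rfl
  -- Curves uniformly close to z remain where the cut-off field equals V, so they solve the original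
  -- equation.
  · have hnear : ∀ᶠ w in 𝓝 (z 0), MapsTo (Z w) univ (O ∩ U) := by
      have h1 : Tendsto Z (𝓝 (z 0)) (𝓝 zc) := by simpa [hZ0] using hZc.continuousAt.tendsto
      have h2 : ∀ᶠ ζ : C(I, E) in 𝓝 zc, MapsTo ζ univ (O ∩ U) :=
        ContinuousMap.eventually_mapsTo isCompact_univ (hO.inter hU)
          fun (t : I) _ => ⟨hzO' t t.2, (hz t t.2).1⟩
      exact h1.eventually h2
    filter_upwards [hZev, hnear] with w hw hwO
    obtain ⟨h0, hd⟩ := ContinuousMap.hasDerivWithinAt_of_eq hw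
    refine ⟨h0, fun t ht => ?_⟩
    have hmem := hwO (mem_univ (⟨t, ht⟩ : I))
    have hdt := hd t ht
    rw [hWcz t ht, hOV _ hmem.1] at hdt
    rw [(Z w).extendUnit_of_mem ht]
    exact ⟨hmem.2, hdt⟩
  · intro v hv
    have hvc : ContinuousOn v I := fun t ht => (hv t ht).continuousWithinAt
    let vc : C(I, E) := ⟨fun t => v t, hvc.domRestrict⟩
    have hvc' : vc = ContinuousMap.const I (v 0) + volterra (Wc'.comp zc) vc := by
      refine ContinuousMap.eq_const_add_primitive (x := v) (fun t ht => ?_) fun t => rfl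
      have h1 : fderiv ℝ W (z t) = fderiv ℝ V (z t) :=
        Filter.EventuallyEq.fderiv_eq (eventually_of_mem (hO.mem_nhds (hzO' t ht)) hOV)
      have h2 := hv t ht
      rw [← h1] at h2
      rwa [ContinuousMap.extendUnit_of_mem _ ht]
    have h1 : (1 - volterra (Wc'.comp zc)) vc = ContinuousMap.const I (v 0) :=
      sub_eq_iff_eq_add.2 hvc'
    obtain ⟨e, he⟩ := isUnit_one_sub_volterra (Wc'.comp zc)
    -- Both sides solve the same Volterra equation with the same right-hand side, and its operator
    -- is injective.
    have h2 : fderiv ℝ Z (z 0) (v 0) = vc := by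
      apply (ContinuousLinearEquiv.unitsEquiv ℝ C(I, E) e).injective
      have h3 := (hZd (v 0)).trans h1.symm
      rw [← he] at h3
      exact h3
    rw [hev]
    have h3 : HasFDerivAt (fun w => ev (Z w)) (ev.comp (fderiv ℝ Z (z 0))) (z 0) :=
      ev.hasFDerivAt.comp _ (hZc.differentiableAt hk').hasFDerivAt
    rw [h3.fderiv, ContinuousLinearMap.comp_apply, h2]
    rfl

end Flow

/-! ### Uniqueness of trajectories and the balance of the first integral -/

/-- Two solutions on `[0, b]` of a `C¹` equation in an open set agree when they start at the same
point. -/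
theorem eqOn_Icc_of_solutions {E : Type*} [NormedAddCommGroup E] [NormedSpace ℝ E]
    [FiniteDimensional ℝ E] {X : Set E} (hX : IsOpen X) {F : E × ℝ → E}
    (hF : ContDiffOn ℝ 1 F (X ×ˢ univ)) {b : ℝ} {x y : ℝ → E}
    (hx : ∀ t ∈ Icc 0 b, x t ∈ X ∧ HasDerivWithinAt x (F (x t, t)) (Icc 0 b) t)
    (hy : ∀ t ∈ Icc 0 b, y t ∈ X ∧ HasDerivWithinAt y (F (y t, t)) (Icc 0 b) t)
    (h0 : x 0 = y 0) : EqOn x y (Icc 0 b) := by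
  have hxc : ContinuousOn x (Icc 0 b) := fun t ht => (hx t ht).2.continuousWithinAt
  have hyc : ContinuousOn y (Icc 0 b) := fun t ht => (hy t ht).2.continuousWithinAt
  have hK : IsCompact ((x '' Icc 0 b ∪ y '' Icc 0 b) ×ˢ Icc 0 b) :=
    ((isCompact_Icc.image_of_continuousOn hxc).union
      (isCompact_Icc.image_of_continuousOn hyc)).prod isCompact_Icc
  obtain ⟨W, hW, hWc, hWF⟩ := exists_contDiff_hasCompactSupport_eq_nhdsSet (k := 1)
    (hX.prod isOpen_univ) hK (by
      rintro ⟨p, t⟩ ⟨hp | hp, -⟩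
      · obtain ⟨s, hs, rfl⟩ := hp
        exact ⟨(hx s hs).1, mem_univ _⟩
      · obtain ⟨s, hs, rfl⟩ := hp
        exact ⟨(hy s hs).1, mem_univ _⟩) (by simpa using hF)
  -- The cut-off field has compact support, hence a global Lipschitz constant, and the standard
  -- uniqueness theorem applies.
  obtain ⟨C, hC⟩ := hW.lipschitzWith_of_hasCompactSupport hWc (by simp)
  have hWF' := hWF.self_of_nhdsSet
  have hright : ∀ {u : ℝ → E} {u' : E} {t : ℝ}, t ∈ Ico 0 b →
      HasDerivWithinAt u u' (Icc 0 b) t → HasDerivWithinAt u u' (Ici t) t := fun ht h =>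
    h.mono_of_mem_nhdsWithin (mem_of_superset (Icc_mem_nhdsGE ht.2) (Icc_subset_Icc_left ht.1))
  refine ODE_solution_unique (v := fun t p => W (p, t)) (K := C) (fun t => ?_) hxc
    (fun t ht => ?_) hyc (fun t ht => ?_) h0
  · simpa [Function.comp_def] using hC.comp (LipschitzWith.prodMk_right t)
  · have ht' := Ico_subset_Icc_self ht
    rw [hWF' _ ⟨Or.inl (mem_image_of_mem x ht'), ht'⟩]
    exact hright ht (hx t ht').2
  · have ht' := Ico_subset_Icc_self ht
    rw [hWF' _ ⟨Or.inr (mem_image_of_mem y ht'), ht'⟩]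
    exact hright ht (hy t ht').2

theorem eq_of_hasDerivWithinAt_zero {E : Type*} [NormedAddCommGroup E] [NormedSpace ℝ E]
    {a b : ℝ} {x : ℝ → E} (hx : ∀ t ∈ Icc a b, HasDerivWithinAt x 0 (Icc a b) t) {t : ℝ}
    (ht : t ∈ Icc a b) : x t = x a :=
  constant_of_has_deriv_right_zero (fun t ht => (hx t ht).continuousWithinAt)
    (fun t ht => (hx t (Ico_subset_Icc_self ht)).mono_of_mem_nhdsWithin
      (mem_of_superset (Icc_mem_nhdsGE ht.2) (Icc_subset_Icc_left ht.1))) t ht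

/-- The system `x' = f x + ε g(x, t; T, ε)` with first integral `H` of the unperturbed part, all of
it of class `C^k`, `k ≥ 1`, and `DH` of class `C^k`. -/
structure IsRegularSystem {n : ℕ} (X : Set (Phase n)) (f : Phase n → Phase n) (H : Phase n → ℝ)
    (g : Phase n → ℝ → ℝ → ℝ → Phase n) (εmax : ℝ) (k : ℕ) : Prop where
  isOpen : IsOpen X
  ne_zero : k ≠ 0
  pos : 0 < εmax
  f_contDiffOn : ContDiffOn ℝ k f X
  H_contDiffOn : ContDiffOn ℝ ((k + 1 : ℕ) : WithTop ℕ∞) H X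
  fderiv_H : ∀ x ∈ X, fderiv ℝ H x (f x) = 0
  g_contDiffOn : ContDiffOn ℝ k (fun q : (Phase n × ℝ × ℝ) × ℝ => g q.1.1 q.2 q.1.2.1 q.1.2.2)
    ((X ×ˢ Ioi (0 : ℝ) ×ˢ Ioo (-εmax) εmax) ×ˢ univ)

namespace IsRegularSystem

variable {n : ℕ} {X : Set (Phase n)} {f : Phase n → Phase n} {H : Phase n → ℝ}
  {g : Phase n → ℝ → ℝ → ℝ → Phase n} {εmax : ℝ} {k : ℕ}

theorem one_le (S : IsRegularSystem X f H g εmax k) : (1 : WithTop ℕ∞) ≤ k := by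
  exact_mod_cast Nat.one_le_iff_ne_zero.2 S.ne_zero

theorem cast_ne_zero (S : IsRegularSystem X f H g εmax k) : (k : WithTop ℕ∞) ≠ 0 := by
  exact_mod_cast S.ne_zero

theorem fderiv_H_contDiffOn (S : IsRegularSystem X f H g εmax k) :
    ContDiffOn ℝ k (fderiv ℝ H) X :=
  S.H_contDiffOn.fderiv_of_isOpen S.isOpen (by norm_cast)

theorem H_hasFDerivAt (S : IsRegularSystem X f H g εmax k) {x : Phase n} (hx : x ∈ X) :
    HasFDerivAt H (fderiv ℝ H x) x :=
  ((S.H_contDiffOn.contDiffAt (S.isOpen.mem_nhds hx)).differentiableAt (by simp)).hasFDerivAt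

/-- The perturbed vector field, in all its arguments, is `C^k`. -/
theorem field_contDiffOn (S : IsRegularSystem X f H g εmax k) :
    ContDiffOn ℝ k (fun q : (Phase n × ℝ × ℝ) × ℝ =>
      f q.1.1 + q.1.2.2 • g q.1.1 q.2 q.1.2.1 q.1.2.2)
    ((X ×ˢ Ioi (0 : ℝ) ×ˢ Ioo (-εmax) εmax) ×ˢ univ) := by
  refine ContDiffOn.add (S.f_contDiffOn.comp (by fun_prop) fun q hq => hq.1.1) ?_
  exact ContDiffOn.smul (f := fun q : (Phase n × ℝ × ℝ) × ℝ => q.1.2.2) (by fun_prop) S.g_contDiffOn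

/-- The power `DH(x) g(x, t; T, ε)` of the perturbation is `C^k`. -/
theorem power_contDiffOn (S : IsRegularSystem X f H g εmax k) :
    ContDiffOn ℝ k (fun q : (Phase n × ℝ × ℝ) × ℝ =>
      fderiv ℝ H q.1.1 (g q.1.1 q.2 q.1.2.1 q.1.2.2))
    ((X ×ˢ Ioi (0 : ℝ) ×ˢ Ioo (-εmax) εmax) ×ˢ univ) :=
  ContDiffOn.clm_apply (S.fderiv_H_contDiffOn.comp (by fun_prop) fun q hq => hq.1.1)
    S.g_contDiffOn

theorem eqOn_trajectories (S : IsRegularSystem X f H g εmax k) {ξ : Phase n} {T ε b : ℝ}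
    (hT : 0 < T) (hε : |ε| < εmax) {x y : ℝ → Phase n} (hx : IsTrajectory X f g ξ T ε b x)
    (hy : IsTrajectory X f g ξ T ε b y) : EqOn x y (Icc 0 b) := by
  refine eqOn_Icc_of_solutions S.isOpen (F := fun q => f q.1 + ε • g q.1 q.2 T ε) ?_ hx.2 hy.2
    (hx.1.trans hy.1.symm)
  exact (S.field_contDiffOn.of_le S.one_le).comp
    (f := fun q : Phase n × ℝ => ((q.1, T, ε), q.2)) (by fun_prop)
    fun q hq => ⟨⟨hq.1, hT, abs_lt.1 hε⟩, mem_univ _⟩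

theorem trajectory_eq (S : IsRegularSystem X f H g εmax k) {ξ : Phase n} {T ε b t : ℝ}
    (hT : 0 < T) (hε : |ε| < εmax) {x : ℝ → Phase n} (hx : IsTrajectory X f g ξ T ε b x)
    (ht : t ∈ Icc 0 b) : trajectory X f g t ξ T ε = x t := by
  have hsub : Icc 0 t ⊆ Icc 0 b := Icc_subset_Icc_right ht.2
  have hx' : IsTrajectory X f g ξ T ε t x :=
    ⟨hx.1, fun s hs => ⟨(hx.2 s (hsub hs)).1, (hx.2 s (hsub hs)).2.mono hsub⟩⟩
  have hex : ∃ x, IsTrajectory X f g ξ T ε t x := ⟨x, hx'⟩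
  rw [trajectory, dif_pos hex]
  exact S.eqOn_trajectories hT hε hex.choose_spec hx' ⟨ht.1, le_rfl⟩

/-- The work `∫₀ᵇ DH(x) g(x, t; T, ε) dt` of the perturbation along trajectories. -/
noncomputable def _root_.work (X : Set (Phase n)) (f : Phase n → Phase n) (H : Phase n → ℝ)
    (g : Phase n → ℝ → ℝ → ℝ → Phase n) (b : ℝ) (ξ : Phase n) (T ε : ℝ) : ℝ :=
  ∫ t in (0 : ℝ)..b, fderiv ℝ H (trajectory X f g t ξ T ε) (g (trajectory X f g t ξ T ε) t T ε)

theorem continuousOn_power (S : IsRegularSystem X f H g εmax k) {T ε b : ℝ}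
    (hT : 0 < T) (hε : |ε| < εmax) {x : ℝ → Phase n} (hx : ContinuousOn x (Icc 0 b))
    (hxX : ∀ t ∈ Icc 0 b, x t ∈ X) :
    ContinuousOn (fun t => fderiv ℝ H (x t) (g (x t) t T ε)) (Icc 0 b) :=
  S.power_contDiffOn.continuousOn.comp
    (f := fun t : ℝ => ((x t, T, ε), t)) (by fun_prop)
    fun t ht => ⟨⟨hxX t ht, hT, abs_lt.1 hε⟩, mem_univ _⟩

theorem work_eq (S : IsRegularSystem X f H g εmax k) {ξ : Phase n} {T ε b : ℝ}
    (hT : 0 < T) (hε : |ε| < εmax) (hb : 0 ≤ b) {x : ℝ → Phase n}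
    (hx : IsTrajectory X f g ξ T ε b x) :
    work X f H g b ξ T ε = ∫ t in (0 : ℝ)..b, fderiv ℝ H (x t) (g (x t) t T ε) := by
  refine intervalIntegral.integral_congr fun t ht => ?_
  rw [uIcc_of_le hb] at ht
  simp only [S.trajectory_eq hT hε hx ht]

/-- The primitive y is left free for two uses: y = H along the trajectory with c = ε gives the
balance of H, and y an extra state coordinate with c = 1 gives smoothness of the work. -/
theorem work_eq_sub (S : IsRegularSystem X f H g εmax k) {ξ : Phase n} {T ε b : ℝ}
    (hT : 0 < T) (hε : |ε| < εmax) (hb : 0 ≤ b) {x : ℝ → Phase n}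
    (hx : IsTrajectory X f g ξ T ε b x) {y : ℝ → ℝ} {c : ℝ}
    (hy : ∀ t ∈ Icc 0 b,
      HasDerivWithinAt y (c * fderiv ℝ H (x t) (g (x t) t T ε)) (Icc 0 b) t) :
    c * work X f H g b ξ T ε = y b - y 0 := by
  have hxc : ContinuousOn x (Icc 0 b) := fun t ht => (hx.2 t ht).2.continuousWithinAt
  rw [S.work_eq hT hε hb hx, ← intervalIntegral.integral_const_mul]
  refine intervalIntegral.integral_eq_sub_of_hasDerivAt_of_le hb
    (fun t ht => (hy t ht).continuousWithinAt)
    (fun t ht => (hy t (Ioo_subset_Icc_self ht)).hasDerivAt (Icc_mem_nhds ht.1 ht.2))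
    (ContinuousOn.intervalIntegrable ?_)
  rw [uIcc_of_le hb]
  exact continuousOn_const.mul (S.continuousOn_power hT hε hxc fun t ht => (hx.2 t ht).1)

/-- The balance of the first integral along a perturbed trajectory. -/
theorem H_trajectory (S : IsRegularSystem X f H g εmax k) {ξ : Phase n} {T ε b : ℝ}
    (hT : 0 < T) (hε : |ε| < εmax) (hb : 0 ≤ b)
    (hx : ∃ x, IsTrajectory X f g ξ T ε b x) :
    H (trajectory X f g b ξ T ε) - H ξ = ε * work X f H g b ξ T ε := by
  obtain ⟨x, hx⟩ := hx
  rw [S.trajectory_eq hT hε hx ⟨hb, le_rfl⟩,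
    S.work_eq_sub hT hε hb hx (y := fun t => H (x t)) (c := ε), hx.1]
  intro t ht
  have h1 := (S.H_hasFDerivAt (hx.2 t ht).1).comp_hasDerivWithinAt t (hx.2 t ht).2
  -- The term DH f vanishes, so only the perturbation does work.
  rwa [map_add, S.fderiv_H _ (hx.2 t ht).1, zero_add, map_smul, smul_eq_mul] at h1

end IsRegularSystem

/-! ### Smoothness of the end point and of the work in (ξ, T, ε) -/

theorem hasDerivWithinAt_fst_comp {E F : Type*} [NormedAddCommGroup E] [NormedSpace ℝ E]
    [NormedAddCommGroup F] [NormedSpace ℝ F] {u : ℝ → E × F} {u' : E × F} {s : Set ℝ} {t : ℝ}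
    (h : HasDerivWithinAt u u' s t) : HasDerivWithinAt (fun t => (u t).1) u'.1 s t :=
  (ContinuousLinearMap.fst ℝ E F).hasFDerivAt.comp_hasDerivWithinAt t h

theorem hasDerivWithinAt_snd_comp {E F : Type*} [NormedAddCommGroup E] [NormedSpace ℝ E]
    [NormedAddCommGroup F] [NormedSpace ℝ F] {u : ℝ → E × F} {u' : E × F} {s : Set ℝ} {t : ℝ}
    (h : HasDerivWithinAt u u' s t) : HasDerivWithinAt (fun t => (u t).2) u'.2 s t :=
  (ContinuousLinearMap.snd ℝ E F).hasFDerivAt.comp_hasDerivWithinAt t h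

namespace IsRegularSystem

variable {n : ℕ} {X : Set (Phase n)} {f : Phase n → Phase n} {H : Phase n → ℝ}
  {g : Phase n → ℝ → ℝ → ℝ → Phase n} {εmax : ℝ} {k : ℕ}

/-- Near a trajectory on `[0, l T₀]` the trajectories exist on `[0, l T]`; their end points and the
work of the perturbation along them are `C^k` functions of `(ξ, T, ε)`. -/
theorem contDiffAt_endpoint (S : IsRegularSystem X f H g εmax k) {l : ℝ} (hl : 0 < l)
    {ξ₀ : Phase n} {T₀ ε₀ : ℝ} (hT₀ : 0 < T₀) (hε₀ : |ε₀| < εmax)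
    (hx₀ : ∃ x, IsTrajectory X f g ξ₀ T₀ ε₀ (l * T₀) x) :
    (∀ᶠ w : Phase n × ℝ × ℝ in 𝓝 (ξ₀, T₀, ε₀),
      ∃ x, IsTrajectory X f g w.1 w.2.1 w.2.2 (l * w.2.1) x) ∧
    ContDiffAt ℝ k (fun w : Phase n × ℝ × ℝ => trajectory X f g (l * w.2.1) w.1 w.2.1 w.2.2)
      (ξ₀, T₀, ε₀) ∧
    ContDiffAt ℝ k (fun w : Phase n × ℝ × ℝ => work X f H g (l * w.2.1) w.1 w.2.1 w.2.2)
      (ξ₀, T₀, ε₀) := by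
  obtain ⟨x₀, hx₀⟩ := hx₀
  let D : Set ((Phase n × ℝ × ℝ) × ℝ) := (X ×ˢ Ioi (0 : ℝ) ×ˢ Ioo (-εmax) εmax) ×ˢ univ
  have hD : IsOpen D := (S.isOpen.prod (isOpen_Ioi.prod isOpen_Ioo)).prod isOpen_univ
  let F : (Phase n × ℝ × ℝ) × ℝ → Phase n := fun q =>
    f q.1.1 + q.1.2.2 • g q.1.1 q.2 q.1.2.1 q.1.2.2
  let G : (Phase n × ℝ × ℝ) × ℝ → ℝ := fun q =>
    fderiv ℝ H q.1.1 (g q.1.1 q.2 q.1.2.1 q.1.2.2)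
  -- Everything becomes an initial value: the state is (((x, T, ε), t), work), with T and ε
  -- constant, and time is rescaled by lT so that the variable interval [0, lT] becomes [0, 1].
  let W : (Phase n × ℝ × ℝ) × ℝ → ((Phase n × ℝ × ℝ) × ℝ) × ℝ := fun q =>
    ((((l * q.1.2.1) • F q, 0, 0), l * q.1.2.1), (l * q.1.2.1) * G q)
  let V : ((Phase n × ℝ × ℝ) × ℝ) × ℝ → ((Phase n × ℝ × ℝ) × ℝ) × ℝ := fun q => W q.1
  have hV : ContDiffOn ℝ k V (D ×ˢ univ) := by
    have hc : ContDiffOn ℝ k (fun q : ((Phase n × ℝ × ℝ) × ℝ) × ℝ => l * q.1.1.2.1)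
        (D ×ˢ univ) := by fun_prop
    have hF := S.field_contDiffOn.comp (f := fun q : ((Phase n × ℝ × ℝ) × ℝ) × ℝ => q.1)
      (s := D ×ˢ univ) (by fun_prop) fun q hq => hq.1
    have hG := S.power_contDiffOn.comp (f := fun q : ((Phase n × ℝ × ℝ) × ℝ) × ℝ => q.1)
      (s := D ×ˢ univ) (by fun_prop) fun q hq => hq.1
    exact (((hc.smul hF).prodMk (contDiffOn_const.prodMk contDiffOn_const)).prodMk hc).prodMk
      (hc.mul hG)
  have hb : 0 < l * T₀ := mul_pos hl hT₀
  have hscale : ∀ {b a : ℝ}, 0 ≤ b → a ∈ I → b * a ∈ Icc 0 b := fun hb ha =>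
    ⟨mul_nonneg hb ha.1, mul_le_of_le_one_right hb ha.2⟩
  have hx₀c : ContinuousOn x₀ (Icc 0 (l * T₀)) := fun t ht =>
    (hx₀.2 t ht).2.continuousWithinAt
  have hpow := S.continuousOn_power hT₀ hε₀ hx₀c fun t ht => (hx₀.2 t ht).1
  let c : C(I, ℝ) := ⟨fun a => (l * T₀) * fderiv ℝ H (x₀ (l * T₀ * a))
      (g (x₀ (l * T₀ * a)) (l * T₀ * a) T₀ ε₀), by
    refine continuous_const.mul (hpow.comp_continuous
      (f := fun a : I => l * T₀ * (a : ℝ)) (by fun_prop) fun a => hscale hb.le a.2)⟩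
  let z : ℝ → ((Phase n × ℝ × ℝ) × ℝ) × ℝ := fun a =>
    (((x₀ (l * T₀ * a), T₀, ε₀), l * T₀ * a), ∫ s in (0 : ℝ)..a, c.extendUnit s)
  have hz0 : z 0 = (((ξ₀, T₀, ε₀), 0), 0) := by
    simp [z, hx₀.1]
  have hlin : ∀ (b a : ℝ), HasDerivWithinAt (fun a : ℝ => b * a) b I a := fun b a => by
    simpa using ((hasDerivAt_id a).const_mul b).hasDerivWithinAt
  have hz : ∀ a ∈ I, z a ∈ D ×ˢ univ ∧ HasDerivWithinAt z (V (z a)) I a := by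
    intro a ha
    have hmem := hscale hb.le ha
    refine ⟨⟨⟨⟨(hx₀.2 _ hmem).1, hT₀, abs_lt.1 hε₀⟩, mem_univ _⟩, mem_univ _⟩, ?_⟩
    have h1 : HasDerivWithinAt (fun a : ℝ => x₀ (l * T₀ * a))
        ((l * T₀) • F (z a).1) I a :=
      (hx₀.2 _ hmem).2.scomp a (hlin _ a) fun s hs => hscale hb.le hs
    have h2 : HasDerivWithinAt (fun a : ℝ => ∫ s in (0 : ℝ)..a, c.extendUnit s)
        (l * T₀ * G (z a).1) I a := by
      have := (c.hasDerivAt_integral_extendUnit (t := a)).hasDerivWithinAt (s := I)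
      rwa [c.extendUnit_of_mem ha] at this
    exact ((h1.prodMk ((hasDerivWithinAt_const _ _ _).prodMk
      (hasDerivWithinAt_const _ _ _))).prodMk (hlin _ a)).prodMk h2
  obtain ⟨Φ, hΦc, -, hΦ, -⟩ := exists_flow_near_curve S.ne_zero (hD.prod isOpen_univ) hV hz
  rw [hz0] at hΦc hΦ
  let j : Phase n × ℝ × ℝ → ((Phase n × ℝ × ℝ) × ℝ) × ℝ := fun w => ((w, 0), 0)
  have hj : ContDiff ℝ k j := by fun_prop
  have hjt : Tendsto j (𝓝 (ξ₀, T₀, ε₀)) (𝓝 (((ξ₀, T₀, ε₀), 0), 0)) :=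
    hj.continuous.tendsto' _ _ rfl
  have key : ∀ᶠ w : Phase n × ℝ × ℝ in 𝓝 (ξ₀, T₀, ε₀),
      (∃ x, IsTrajectory X f g w.1 w.2.1 w.2.2 (l * w.2.1) x) ∧
      trajectory X f g (l * w.2.1) w.1 w.2.1 w.2.2 = (Φ (j w) 1).1.1.1 ∧
      work X f H g (l * w.2.1) w.1 w.2.1 w.2.2 = (Φ (j w) 1).2 := by
    filter_upwards [hjt.eventually hΦ] with w hw
    obtain ⟨⟨ξ, T, ε⟩, h0, hu⟩ := w, hw
    set u := Φ (j (ξ, T, ε))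
    have h00 : (0 : ℝ) ∈ I := ⟨le_rfl, zero_le_one⟩
    -- The solution starts in the domain of the field, so the constraints on T and ε can be read off
    -- at time 0.
    have hTpos : 0 < T := by
      have := (hu 0 h00).1.1.1.2.1
      rwa [h0] at this
    have hε : |ε| < εmax := by
      have := (hu 0 h00).1.1.1.2.2
      rw [h0] at this
      exact abs_lt.2 this
    have hlT : 0 < l * T := mul_pos hl hTpos
    have hu1 := fun a ha => hasDerivWithinAt_fst_comp (hu a ha).2
    have hu11 := fun a ha => hasDerivWithinAt_fst_comp (hu1 a ha)
    -- The auxiliary coordinates are integrated explicitly, so that the field along u is the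
    -- original one at time t = lTa.
    have huT : ∀ a ∈ I, (u a).1.1.2 = (T, ε) := fun a ha => by
      have := eq_of_hasDerivWithinAt_zero (x := fun a => (u a).1.1.2)
        (fun a ha => hasDerivWithinAt_snd_comp (hu11 a ha)) ha
      rw [this, h0]
    have hut : ∀ a ∈ I, (u a).1.2 = l * T * a := fun a ha => by
      have := eq_of_hasDerivWithinAt_zero (x := fun a => (u a).1.2 - l * T * a)
        (fun a ha => by
          have h1 := (hasDerivWithinAt_snd_comp (hu1 a ha)).sub (hlin (l * T) a)
          have h2 : (V (u a)).1.2 - l * T = 0 := by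
            simp only [V, W, huT a ha, sub_self]
          rwa [h2] at h1) ha
      rw [h0] at this
      simpa [j, sub_eq_zero] using this
    have hin : ∀ t ∈ Icc 0 (l * T), t / (l * T) ∈ I := fun t ht =>
      ⟨div_nonneg ht.1 hlT.le, (div_le_one hlT).2 ht.2⟩
    have hdiv : ∀ t, HasDerivWithinAt (fun t : ℝ => t / (l * T)) (1 / (l * T))
        (Icc 0 (l * T)) t := fun t => ((hasDerivAt_id t).div_const _).hasDerivWithinAt
    have hpt : ∀ t ∈ Icc 0 (l * T), (u (t / (l * T))).1 =
        (((u (t / (l * T))).1.1.1, T, ε), t) := fun t ht => by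
      have h1 := huT _ (hin t ht)
      have h2 := hut _ (hin t ht)
      rw [mul_div_cancel₀ _ hlT.ne'] at h2
      ext1
      · ext1
        · rfl
        · exact h1
      · exact h2
    have hx : IsTrajectory X f g ξ T ε (l * T) (fun t => (u (t / (l * T))).1.1.1) := by
      refine ⟨by simp [h0, j], fun t ht => ⟨(hu _ (hin t ht)).1.1.1.1, ?_⟩⟩
      have h1 := (hasDerivWithinAt_fst_comp (hu11 _ (hin t ht))).scomp t (hdiv t) fun s hs => hin s hs
      have h2 : (1 / (l * T)) • (V (u (t / (l * T)))).1.1.1 =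
          (1 / (l * T)) • (l * T) • F (((u (t / (l * T))).1.1.1, T, ε), t) :=
        congrArg (fun p => (1 / (l * T)) • (W p).1.1.1) (hpt t ht)
      rw [h2, smul_smul, one_div_mul_cancel hlT.ne', one_smul] at h1
      exact h1
    refine ⟨⟨_, hx⟩, ?_, ?_⟩
    · rw [S.trajectory_eq hTpos hε hx ⟨hlT.le, le_rfl⟩, div_self hlT.ne']
    · have hy := S.work_eq_sub hTpos hε hlT.le hx (y := fun t => (u (t / (l * T))).2) (c := 1)
        (fun t ht => by
          have h1 := (hasDerivWithinAt_snd_comp (hu _ (hin t ht)).2).scomp t (hdiv t) fun s hs => hin s hs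
          have h2 : (1 / (l * T)) • (V (u (t / (l * T)))).2 =
              (1 / (l * T)) * (l * T * G (((u (t / (l * T))).1.1.1, T, ε), t)) :=
            congrArg (fun p => (1 / (l * T)) • (W p).2) (hpt t ht)
          rw [h2, ← mul_assoc, one_div_mul_cancel hlT.ne'] at h1
          exact h1)
      simpa [h0, j, div_self hlT.ne'] using hy
  have hΦj : ContDiffAt ℝ k (fun w => Φ (j w) 1) (ξ₀, T₀, ε₀) :=
    ContDiffAt.comp (g := fun w => Φ w 1) (f := j) _ hΦc hj.contDiffAt
  refine ⟨key.mono fun w hw => hw.1, ?_, ?_⟩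
  · refine ContDiffAt.congr_of_eventuallyEq ?_ (key.mono fun w hw => hw.2.1)
    exact hΦj.fst.fst.fst
  · refine ContDiffAt.congr_of_eventuallyEq ?_ (key.mono fun w hw => hw.2.2)
    exact hΦj.snd

end IsRegularSystem

/-! ### Linear algebra of m-normality -/

/-- The kernel of `(η, c) ↦ A η + c f₀` is spanned by `(f₀, 0)` and a vector on which `φ = 1`; hence
`(f₀, 0)` spans its intersection with `ker φ`. -/
theorem exists_smul_eq_of_normal {E : Type*} [AddCommGroup E] [Module ℝ E] [FiniteDimensional ℝ E]
    {A : E →ₗ[ℝ] E} {f₀ : E} (hf₀ : f₀ ≠ 0) (hA : A f₀ = 0)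
    (hker : Module.finrank ℝ (LinearMap.ker A) = 1 ∨
      (Module.finrank ℝ (LinearMap.ker A) = 2 ∧ f₀ ∉ LinearMap.range A))
    {φ : E × ℝ →ₗ[ℝ] ℝ} (hφ : φ (f₀, 0) = 0) {v : E} {d : ℝ} (hv : A v + d • f₀ = 0)
    (hφv : φ (v, d) = 1) {η : E} {c : ℝ} (hη : A η + c • f₀ = 0) (hφη : φ (η, c) = 0) :
    c = 0 ∧ ∃ a : ℝ, a • f₀ = η := by
  rcases hker with h1 | ⟨h2, hr⟩
  · have hspan : ∀ w, A w = 0 → ∃ a : ℝ, a • f₀ = w := fun w hw => by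
      obtain ⟨a, ha⟩ := (finrank_eq_one_iff_of_nonzero' (⟨f₀, hA⟩ : LinearMap.ker A)
        (fun h => hf₀ (congrArg Subtype.val h))).1 h1 ⟨w, hw⟩
      exact ⟨a, congrArg Subtype.val ha⟩
    have hφs : ∀ a : ℝ, φ (a • f₀, 0) = 0 := fun a => by
      have : ((a • f₀, 0) : E × ℝ) = a • (f₀, 0) := by simp
      rw [this, map_smul, hφ, smul_zero]
    -- If d = 0, then v lies in the kernel, hence is a multiple of f₀, contradicting φ(v, d) = 1.
    have hd : d ≠ 0 := by
      rintro rfl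
      obtain ⟨a, rfl⟩ := hspan v (by simpa using hv)
      rw [hφs] at hφv
      exact zero_ne_one hφv
    -- Subtracting the multiple of (v, d) that cancels the second component leaves a kernel vector
    -- of A; then φ shows that the multiple is zero.
    have hw : A (η - (c / d) • v) = 0 := by
      rw [map_sub, map_smul, eq_neg_of_add_eq_zero_left hη, eq_neg_of_add_eq_zero_left hv,
        smul_neg, smul_smul, div_mul_cancel₀ _ hd, sub_self]
    obtain ⟨a, ha⟩ := hspan _ hw
    have h3 : ((η, c) : E × ℝ) = (a • f₀, 0) + (c / d) • (v, d) := by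
      ext
      · simp [ha]
      · simp [hd]
    rw [h3, map_add, map_smul, hφs, hφv] at hφη
    have hc : c = 0 := by
      simpa [hd] using hφη
    subst hc
    exact ⟨rfl, a, by simpa using ha⟩
  -- As f₀ is not in the range, every second component vanishes.
  · have hz : ∀ {w : E} {c : ℝ}, A w + c • f₀ = 0 → c = 0 := fun {w c} h => by
      by_contra hc
      refine hr ⟨-c⁻¹ • w, ?_⟩
      rw [map_smul, eq_neg_of_add_eq_zero_left h, neg_smul, smul_neg, neg_neg, smul_smul,
        inv_mul_cancel₀ hc, one_smul]
    obtain rfl := hz hη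
    obtain rfl := hz hv
    refine ⟨rfl, ?_⟩
    -- On the two-dimensional kernel of A the functional φ(·, 0) is onto because of v, so its own
    -- kernel is a line, and that line contains f₀.
    let ψ : LinearMap.ker A →ₗ[ℝ] ℝ := (φ ∘ₗ LinearMap.inl ℝ E ℝ).domRestrict _
    have hψs : Function.Surjective ψ := fun r => by
      refine ⟨r • ⟨v, by simpa using hv⟩, ?_⟩
      rw [map_smul]
      change r • φ (v, 0) = r
      rw [hφv, smul_eq_mul, mul_one]
    have h4 := ψ.finrank_range_add_finrank_ker
    rw [LinearMap.range_eq_top.2 hψs, finrank_top, Module.finrank_self, h2] at h4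
    have h5 : Module.finrank ℝ (LinearMap.ker ψ) = 1 := by omega
    obtain ⟨a, ha⟩ := (finrank_eq_one_iff_of_nonzero'
      (⟨⟨f₀, hA⟩, hφ⟩ : LinearMap.ker ψ)
      (fun h => hf₀ (congrArg (fun x => (x : LinearMap.ker A).1) (congrArg Subtype.val h)))).1 h5
      ⟨⟨η, by simpa using hη⟩, hφη⟩
    exact ⟨a, congrArg (fun x => (x : LinearMap.ker A).1) (congrArg Subtype.val ha)⟩

/-! ### The equation of variations along a periodic orbit -/

namespace IsPeriodicOrbit

variable {n : ℕ} {X : Set (Phase n)} {f : Phase n → Phase n} {γ : ℝ → Phase n} {τ : ℝ}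

theorem continuous (hγ : IsPeriodicOrbit X f γ τ) : Continuous γ :=
  continuous_iff_continuousAt.2 fun t => (hγ.hasDerivAt t).continuousAt

theorem periodic_nat (hγ : IsPeriodicOrbit X f γ τ) (j : ℕ) (t : ℝ) : γ (t + j * τ) = γ t := by
  have := (show Function.Periodic γ τ from hγ.periodic).nat_mul j
  exact this t

theorem isTrajectory (hγ : IsPeriodicOrbit X f γ τ) (g : Phase n → ℝ → ℝ → ℝ → Phase n)
    (s T b : ℝ) : IsTrajectory X f g (γ s) T 0 b (fun t => γ (s + t)) := by
  refine ⟨by simp, fun t _ => ⟨hγ.mem _, ?_⟩⟩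
  rw [zero_smul, add_zero]
  exact ((hγ.hasDerivAt (s + t)).comp_const_add s t).hasDerivWithinAt

/-- Solutions of the equation of variations along a periodic orbit are determined by their value at
one point. -/
theorem variational_unique (hγ : IsPeriodicOrbit X f γ τ) (hX : IsOpen X)
    (hf : ContDiffOn ℝ 1 f X) {v w : ℝ → Phase n}
    (hv : ∀ t, HasDerivAt v (fderiv ℝ f (γ t) (v t)) t)
    (hw : ∀ t, HasDerivAt w (fderiv ℝ f (γ t) (w t)) t) {t₀ : ℝ} (h : v t₀ = w t₀) : v = w := by
  have hc : Continuous fun t => fderiv ℝ f (γ t) :=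
    (hf.continuousOn_fderiv_of_isOpen hX le_rfl).comp_continuous hγ.continuous hγ.mem
  -- Periodicity bounds Df along the whole orbit, giving one Lipschitz constant for all times.
  have hp : Function.Periodic (fun t => fderiv ℝ f (γ t)) τ := fun t => by
    simp only [hγ.periodic t]
  obtain ⟨C, hC⟩ := (hp.isBounded_of_continuous hγ.period_pos.ne' hc).exists_norm_le
  refine ODE_solution_unique_univ (v := fun t x => fderiv ℝ f (γ t) x) (s := fun _ => univ)
    (K := C.toNNReal) (fun t => ?_) (fun t => ⟨hv t, mem_univ _⟩) (fun t => ⟨hw t, mem_univ _⟩) h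
  refine ((fderiv ℝ f (γ t)).lipschitz.weaken ?_).lipschitzOnWith
  rw [← NNReal.coe_le_coe]
  exact (hC _ (mem_range_self t)).trans (Real.le_coe_toNNReal C)

theorem variational_field (hγ : IsPeriodicOrbit X f γ τ) (hX : IsOpen X)
    (hf : ContDiffOn ℝ 1 f X) (t : ℝ) :
    HasDerivAt (fun t => f (γ t)) (fderiv ℝ f (γ t) (f (γ t))) t :=
  ((hf.contDiffAt (hX.mem_nhds (hγ.mem t))).differentiableAt
    one_ne_zero).hasFDerivAt.comp_hasDerivAt t (hγ.hasDerivAt t)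

/-- f ∘ γ solves the equation of variations, so one zero would make it vanish identically and γ
constant, against minimality of the period. -/
theorem field_ne_zero (hγ : IsPeriodicOrbit X f γ τ) (hX : IsOpen X)
    (hf : ContDiffOn ℝ 1 f X) (t : ℝ) : f (γ t) ≠ 0 := by
  intro h
  have h0 : (fun t => f (γ t)) = fun _ => 0 :=
    hγ.variational_unique hX hf (hγ.variational_field hX hf)
      (fun t => by simpa using hasDerivAt_const t (0 : Phase n)) (t₀ := t) h
  have h1 : γ (τ / 2) = γ 0 := by
    refine is_const_of_deriv_eq_zero (fun t => (hγ.hasDerivAt t).differentiableAt) (fun t => ?_) _ _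
    rw [(hγ.hasDerivAt t).deriv]
    exact congrFun h0 t
  exact hγ.minimal _ (half_pos hγ.period_pos) (half_lt_self hγ.period_pos) h1

section Variational

variable {Y : ℝ → (Phase n →L[ℝ] Phase n)}

theorem hasDerivAt_column (hY : IsVariationalSolution f γ Y) (η : Phase n) (t : ℝ) :
    HasDerivAt (fun t => Y t η) (fderiv ℝ f (γ t) (Y t η)) t := by
  have h1 := ((ContinuousLinearMap.apply ℝ (Phase n) η).hasFDerivAt (x := Y t)).comp_hasDerivAt t
    (hY.2 t)
  exact h1

/-- Floquet's relation: Df ∘ γ being τ-periodic, a shift by τ sends solutions to solutions, and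
these are determined by their value at 0. -/
theorem variational_add_period (hγ : IsPeriodicOrbit X f γ τ) (hX : IsOpen X)
    (hf : ContDiffOn ℝ 1 f X) (hY : IsVariationalSolution f γ Y) (j : ℕ) (η : Phase n) (t : ℝ) :
    Y (t + j * τ) η = Y t ((Y τ ^ j) η) := by
  induction j generalizing t with
  | zero => simp
  | succ j ih =>
    have h1 : (fun t => Y (t + τ) ((Y τ ^ j) η)) = fun t => Y t (Y τ ((Y τ ^ j) η)) := by
      refine hγ.variational_unique hX hf (t₀ := 0) (fun t => ?_)
        (hasDerivAt_column hY _) (by simp [hY.1])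
      have := (hasDerivAt_column hY ((Y τ ^ j) η) (t + τ)).comp_add_const t τ
      rwa [hγ.periodic] at this
    have h2 : t + ((j + 1 : ℕ) : ℝ) * τ = (t + τ) + j * τ := by push_cast; ring
    rw [h2, ih, pow_succ']
    exact congrFun h1 t

theorem variational_injective (hγ : IsPeriodicOrbit X f γ τ) (hX : IsOpen X)
    (hf : ContDiffOn ℝ 1 f X) (hY : IsVariationalSolution f γ Y) (s : ℝ) :
    Function.Injective (Y s) := by
  rw [injective_iff_map_eq_zero]
  intro η hη
  have h1 : (fun t => Y t η) = fun _ => 0 :=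
    hγ.variational_unique hX hf (hasDerivAt_column hY η)
      (fun t => by simpa using hasDerivAt_const t (0 : Phase n)) (t₀ := s) hη
  simpa [hY.1] using congrFun h1 0

theorem variational_surjective (hγ : IsPeriodicOrbit X f γ τ) (hX : IsOpen X)
    (hf : ContDiffOn ℝ 1 f X) (hY : IsVariationalSolution f γ Y) (s : ℝ) :
    Function.Surjective (Y s) :=
  (LinearMap.injective_iff_surjective (f := (Y s : Phase n →ₗ[ℝ] Phase n))).1
    (hγ.variational_injective hX hf hY s)

theorem variational_apply_field (hγ : IsPeriodicOrbit X f γ τ) (hX : IsOpen X)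
    (hf : ContDiffOn ℝ 1 f X) (hY : IsVariationalSolution f γ Y) (s : ℝ) :
    Y s (f (γ 0)) = f (γ s) :=
  congrFun (hγ.variational_unique hX hf (hasDerivAt_column hY _)
    (hγ.variational_field hX hf) (t₀ := 0) (by simp [hY.1])) s

end Variational

end IsPeriodicOrbit

/-! ### Derivatives of the unperturbed flow and nondegeneracy -/

namespace IsRegularSystem

variable {n : ℕ} {X : Set (Phase n)} {f : Phase n → Phase n} {H : Phase n → ℝ}
  {g : Phase n → ℝ → ℝ → ℝ → Phase n} {εmax : ℝ} {k : ℕ}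

theorem abs_zero_lt (S : IsRegularSystem X f H g εmax k) : |(0 : ℝ)| < εmax := by
  simpa using S.pos

/-- The derivative of the unperturbed flow in the initial value is given by the equation of
variations. -/
theorem exists_hasFDerivAt_flow (S : IsRegularSystem X f H g εmax k) {c : ℝ → Phase n}
    (hc : ∀ t, c t ∈ X ∧ HasDerivAt c (f (c t)) t) {b T : ℝ} (hb : 0 < b) (hT : 0 < T) :
    (∀ᶠ ξ in 𝓝 (c 0), ∃ x, IsTrajectory X f g ξ T 0 b x) ∧
    ∃ D : Phase n →L[ℝ] Phase n, HasFDerivAt (fun ξ => trajectory X f g b ξ T 0) D (c 0) ∧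
      ∀ v : ℝ → Phase n, (∀ t, HasDerivAt v (fderiv ℝ f (c t) (v t)) t) → D (v 0) = v b := by
  have hlin : ∀ a, HasDerivAt (fun a : ℝ => b * a) b a := fun a => by
    simpa using (hasDerivAt_id a).const_mul b
  obtain ⟨Φ, hΦc, -, hΦ, hΦd⟩ := exists_flow_near_curve (V := fun x => b • f x) S.ne_zero S.isOpen
    (S.f_contDiffOn.const_smul b) (z := fun a => c (b * a)) (fun a _ =>
      ⟨(hc _).1, ((hc (b * a)).2.scomp a (hlin a)).hasDerivWithinAt⟩)
  simp only [mul_zero] at hΦc hΦ hΦd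
  have key : ∀ᶠ ξ in 𝓝 (c 0), IsTrajectory X f g ξ T 0 b (fun t => Φ ξ (t / b)) := by
    filter_upwards [hΦ] with ξ hξ
    refine ⟨by simp [hξ.1], fun t ht => ?_⟩
    have hin : ∀ t ∈ Icc 0 b, t / b ∈ I := fun t ht =>
      ⟨div_nonneg ht.1 hb.le, (div_le_one hb).2 ht.2⟩
    have hdiv : HasDerivWithinAt (fun t : ℝ => t / b) (1 / b) (Icc 0 b) t :=
      ((hasDerivAt_id t).div_const _).hasDerivWithinAt
    refine ⟨(hξ.2 _ (hin t ht)).1, ?_⟩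
    have h1 := (hξ.2 _ (hin t ht)).2.scomp t hdiv hin
    rw [smul_smul, one_div_mul_cancel hb.ne', one_smul] at h1
    rw [zero_smul, add_zero]
    exact h1
  refine ⟨key.mono fun ξ h => ⟨_, h⟩, fderiv ℝ (fun ξ => Φ ξ 1) (c 0), ?_, fun v hv => ?_⟩
  · refine (hΦc.differentiableAt S.cast_ne_zero).hasFDerivAt.congr_of_eventuallyEq ?_
    filter_upwards [key] with ξ hξ
    rw [S.trajectory_eq hT S.abs_zero_lt hξ ⟨hb.le, le_rfl⟩, div_self hb.ne']
  · have h1 := hΦd (fun a => v (b * a)) fun a _ => by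
      have h2 := ((hv (b * a)).scomp a (hlin a)).hasDerivWithinAt (s := I)
      have h3 : fderiv ℝ (fun x => b • f x) (c (b * a)) = b • fderiv ℝ f (c (b * a)) :=
        fderiv_const_smul ((S.f_contDiffOn.contDiffAt
          (S.isOpen.mem_nhds (hc _).1)).differentiableAt S.cast_ne_zero) b
      rw [h3]
      exact h2
    simpa using h1

end IsRegularSystem

namespace IsRegularSystem

variable {n : ℕ} {X : Set (Phase n)} {f : Phase n → Phase n} {H : Phase n → ℝ}
  {g : Phase n → ℝ → ℝ → ℝ → Phase n} {εmax : ℝ} {k : ℕ} {γ : ℝ → Phase n} {τ : ℝ}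
  {Y : ℝ → (Phase n →L[ℝ] Phase n)}

theorem trajectory_periodicOrbit (S : IsRegularSystem X f H g εmax k)
    (hγ : IsPeriodicOrbit X f γ τ) {T b : ℝ} (hT : 0 < T) (hb : 0 ≤ b) (s : ℝ) :
    trajectory X f g b (γ s) T 0 = γ (s + b) :=
  S.trajectory_eq hT S.abs_zero_lt (hγ.isTrajectory g s T b) ⟨hb, le_rfl⟩

theorem exists_hasFDerivAt_flow_orbit (S : IsRegularSystem X f H g εmax k)
    (hγ : IsPeriodicOrbit X f γ τ) (hY : IsVariationalSolution f γ Y) {b T : ℝ} (hb : 0 < b)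
    (hT : 0 < T) (s : ℝ) :
    (∀ᶠ ξ in 𝓝 (γ s), ∃ x, IsTrajectory X f g ξ T 0 b x) ∧
    ∃ D : Phase n →L[ℝ] Phase n, HasFDerivAt (fun ξ => trajectory X f g b ξ T 0) D (γ s) ∧
      ∀ η, D (Y s η) = Y (s + b) η := by
  have h := S.exists_hasFDerivAt_flow (c := fun t => γ (s + t))
    (fun t => ⟨hγ.mem _, (hγ.hasDerivAt (s + t)).comp_const_add s t⟩) hb hT
  simp only [add_zero] at h
  obtain ⟨h1, D, hD, hDv⟩ := h
  refine ⟨h1, D, hD, fun η => ?_⟩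
  have h2 := hDv (fun t => Y (s + t) η) fun t =>
    (IsPeriodicOrbit.hasDerivAt_column hY η (s + t)).comp_const_add s t
  simpa using h2

/-- `DH(γ s) Y(s) = DH(γ 0)`. -/
theorem fderiv_H_variational (S : IsRegularSystem X f H g εmax k)
    (hγ : IsPeriodicOrbit X f γ τ) (hY : IsVariationalSolution f γ Y) {s : ℝ} (hs : 0 < s)
    (η : Phase n) : fderiv ℝ H (γ s) (Y s η) = fderiv ℝ H (γ 0) η := by
  obtain ⟨hex, D, hD, hDY⟩ := S.exists_hasFDerivAt_flow_orbit hγ hY hs one_pos 0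
  have h0 : trajectory X f g s (γ 0) 1 0 = γ s := by
    rw [S.trajectory_periodicOrbit hγ one_pos hs.le, zero_add]
  have hH := S.H_hasFDerivAt (hγ.mem s)
  rw [← h0] at hH
  have h1 := hH.comp (γ 0) hD
  -- At ε = 0 the balance says that H composed with the flow is H near γ 0; differentiate this. The
  -- period argument 1 is a dummy, since g drops out.
  have h2 : HasFDerivAt H ((fderiv ℝ H (γ s)).comp D) (γ 0) := by
    rw [h0] at h1
    refine h1.congr_of_eventuallyEq ?_
    filter_upwards [hex] with ξ hξ
    have := S.H_trajectory one_pos S.abs_zero_lt hs.le hξ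
    rw [zero_mul, sub_eq_zero] at this
    exact this.symm
  rw [h2.fderiv, ContinuousLinearMap.comp_apply]
  have h3 := hDY η
  rw [hY.1, zero_add] at h3
  exact congrArg _ h3.symm

theorem endpoint_properties (S : IsRegularSystem X f H g εmax k) (hγ : IsPeriodicOrbit X f γ τ)
    {l T₀ : ℝ} (hl : 0 < l) (hT₀ : 0 < T₀) (s : ℝ) :
    (∀ᶠ w : Phase n × ℝ × ℝ in 𝓝 (γ s, T₀, 0),
      ∃ x, IsTrajectory X f g w.1 w.2.1 w.2.2 (l * w.2.1) x) ∧
    ContDiffAt ℝ k (fun w : Phase n × ℝ × ℝ => trajectory X f g (l * w.2.1) w.1 w.2.1 w.2.2)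
      (γ s, T₀, 0) ∧
    ContDiffAt ℝ k (fun w : Phase n × ℝ × ℝ => work X f H g (l * w.2.1) w.1 w.2.1 w.2.2)
      (γ s, T₀, 0) :=
  S.contDiffAt_endpoint hl hT₀ S.abs_zero_lt ⟨_, hγ.isTrajectory g s T₀ _⟩

/-- The derivative of the end point map at the unperturbed periodic orbit. -/
theorem fderiv_endpoint (S : IsRegularSystem X f H g εmax k) (hγ : IsPeriodicOrbit X f γ τ)
    (hY : IsVariationalSolution f γ Y) {l T₀ : ℝ} {m : ℕ} (hl : 0 < l) (hT₀ : 0 < T₀)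
    (hlT : l * T₀ = m * τ) (s : ℝ) (η : Phase n) (c : ℝ) :
    fderiv ℝ (fun w : Phase n × ℝ × ℝ => trajectory X f g (l * w.2.1) w.1 w.2.1 w.2.2)
      (γ s, T₀, 0) (Y s η, c, 0) = Y s ((Y τ ^ m) η) + (l * c) • f (γ s) := by
  set P := fun w : Phase n × ℝ × ℝ => trajectory X f g (l * w.2.1) w.1 w.2.1 w.2.2
  have hP : HasFDerivAt P (fderiv ℝ P (γ s, T₀, 0)) (γ s, T₀, 0) :=
    ((S.endpoint_properties hγ hl hT₀ s).2.1.differentiableAt S.cast_ne_zero).hasFDerivAt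
  have hb : 0 < l * T₀ := mul_pos hl hT₀
  -- The ξ-derivative is the flow derivative over time mτ, expressed by Floquet's relation; the
  -- T-derivative below is computed by following the orbit itself.
  have h1 : fderiv ℝ P (γ s, T₀, 0) (Y s η, 0, 0) = Y s ((Y τ ^ m) η) := by
    obtain ⟨-, D, hD, hDY⟩ := S.exists_hasFDerivAt_flow_orbit hγ hY hb hT₀ s
    have h2 := hP.comp (γ s) (hasFDerivAt_prodMk_left (𝕜 := ℝ) (γ s) ((T₀, 0) : ℝ × ℝ))
    have h3 := DFunLike.congr_fun (h2.unique hD) (Y s η)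
    rw [hDY, hlT, hγ.variational_add_period S.isOpen (S.f_contDiffOn.of_le S.one_le) hY] at h3
    exact h3
  have h2 : fderiv ℝ P (γ s, T₀, 0) (0, 1, 0) = l • f (γ s) := by
    have h3 : HasDerivAt (fun T : ℝ => ((γ s, T, 0) : Phase n × ℝ × ℝ)) (0, 1, 0) T₀ :=
      (hasDerivAt_const _ _).prodMk ((hasDerivAt_id _).prodMk (hasDerivAt_const _ _))
    have h4 := hP.comp_hasDerivAt T₀ h3
    have h5 : HasDerivAt (fun T : ℝ => γ (s + l * T)) (l • f (γ (s + l * T₀))) T₀ := by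
      have h6 : HasDerivAt (fun T : ℝ => s + l * T) l T₀ := by
        simpa using ((hasDerivAt_id T₀).const_mul l).const_add s
      exact (hγ.hasDerivAt _).scomp T₀ h6
    rw [hlT, hγ.periodic_nat] at h5
    refine h4.unique (h5.congr_of_eventuallyEq ?_)
    filter_upwards [eventually_gt_nhds hT₀] with T hT
    exact S.trajectory_periodicOrbit hγ hT (mul_pos hl hT).le s
  have h3 : ((Y s η, c, 0) : Phase n × ℝ × ℝ) = (Y s η, 0, 0) + c • (0, 1, 0) := by simp
  rw [h3, map_add, map_smul, h1, h2, smul_smul, mul_comm c]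

/-- Transporting by Y(s) to the base point reduces the three equations to the kernel statement
`exists_smul_eq_of_normal`, with (v, d) the tangent of the family of periodic orbits. Positive s is
assumed because flow derivatives are available for forward times only. -/
theorem partial_injective_of_pos (S : IsRegularSystem X f H g εmax k)
    (hγ : IsPeriodicOrbit X f γ τ) {l T₀ : ℝ} {m : ℕ} (hl : 0 < l) (hT₀ : 0 < T₀)
    (hlT : l * T₀ = m * τ) (hm : 0 < m) (hDH : fderiv ℝ H (γ 0) ≠ 0) (hnormal : IsMNormal f γ τ m)
    {L : Phase n × ℝ → ℝ} (hLd : ∀ t, DifferentiableAt ℝ L (γ t, m * τ))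
    (hL : ParametrisesFamily X f γ τ m L) {s : ℝ} (hs : 0 < s) :
    fderiv ℝ H (γ s) ≠ 0 ∧
    ∀ (η : Phase n) (c μ : ℝ),
      fderiv ℝ (fun w : Phase n × ℝ × ℝ => trajectory X f g (l * w.2.1) w.1 w.2.1 w.2.2)
        (γ s, T₀, 0) (η, c, 0) - η - μ • gradient H (γ s) = 0 →
      fderiv ℝ L (γ s, m * τ) (η, l * c) = 0 → inner ℝ η (f (γ s)) = 0 →
      η = 0 ∧ c = 0 ∧ μ = 0 := by
  obtain ⟨Y, hY, hker⟩ := hnormal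
  have hf1 := S.f_contDiffOn.of_le S.one_le
  have hDHs : fderiv ℝ H (γ s) ≠ 0 := fun h => by
    refine hDH (ContinuousLinearMap.ext fun η => ?_)
    rw [← S.fderiv_H_variational hγ hY hs, h]
    rfl
  refine ⟨hDHs, fun η c μ h1 h2 h3 => ?_⟩
  obtain ⟨η, rfl⟩ := hγ.variational_surjective S.isOpen hf1 hY s η
  rw [S.fderiv_endpoint hγ hY hl hT₀ hlT] at h1
  have hgrad : ∀ x, fderiv ℝ H (γ s) x = inner ℝ (gradient H (γ s)) x := fun x =>
    InnerProductSpace.toDual_symm_apply.symm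
  have hgne : gradient H (γ s) ≠ 0 := fun h => hDHs
    (ContinuousLinearMap.ext fun x => by rw [hgrad, h, inner_zero_left]; rfl)
  -- Apply DH(γ s): H is invariant under the flow, so every term cancels except -μ‖∇H‖².
  have hμ : μ = 0 := by
    have h4 := congrArg (fderiv ℝ H (γ s)) h1
    have h5 : fderiv ℝ H (γ s) (Y s ((Y τ ^ m) η)) = fderiv ℝ H (γ s) (Y s η) := by
      rw [S.fderiv_H_variational hγ hY hs η, ← hγ.variational_add_period S.isOpen hf1 hY,
        ← hγ.periodic_nat m, S.fderiv_H_variational hγ hY]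
      have := hγ.period_pos
      positivity
    rw [map_sub, map_sub, map_add, map_smul, map_smul, S.fderiv_H _ (hγ.mem s), h5, map_zero,
      smul_zero, add_zero, sub_self, zero_sub, neg_eq_zero, hgrad] at h4
    exact (smul_eq_zero.1 h4).resolve_right (inner_self_ne_zero.2 hgne)
  subst hμ
  have hf0 : Y s (f (γ 0)) = f (γ s) := hγ.variational_apply_field S.isOpen hf1 hY s
  have hinj := hγ.variational_injective S.isOpen hf1 hY s
  have hη : (Y τ ^ m - 1 : Phase n →L[ℝ] Phase n) η + (l * c) • f (γ 0) = 0 := by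
    apply hinj
    rw [map_add, map_smul, hf0, map_zero, ← h1]
    change Y s ((Y τ ^ m) η - η) + _ = _
    rw [map_sub, zero_smul]
    abel
  obtain ⟨u, p, hu0, hp0, hu, hp, hfam⟩ := hL
  set lam := L (γ 0, m * τ) with hlam
  have hud : HasDerivAt (fun a => u a 0) (deriv (fun a => u a 0) lam) lam :=
    (hu.differentiableAt one_ne_zero).hasDerivAt
  have hpd : HasDerivAt p (deriv p lam) lam := (hp.differentiableAt one_ne_zero).hasDerivAt
  set v := deriv (fun a => u a 0) lam
  set p' := deriv p lam
  -- The family is differentiable in its parameter at λ₀ only through initial points; the flow over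
  -- time s carries this to the points at time s.
  have hus : HasDerivAt (fun a => u a s) (Y s v) lam := by
    obtain ⟨-, D, hD, hDY⟩ := S.exists_hasFDerivAt_flow_orbit hγ hY hs one_pos 0
    have h4 : D v = Y s v := by
      have := hDY v
      rwa [hY.1, zero_add] at this
    rw [← h4]
    have hD' : HasFDerivAt (fun ξ => trajectory X f g s ξ 1 0) D ((fun a => u a 0) lam) := by
      simpa [hu0] using hD
    refine (hD'.comp_hasDerivAt lam hud).congr_of_eventuallyEq ?_
    filter_upwards [hfam] with a ha
    have := S.trajectory_periodicOrbit ha.1 one_pos hs.le 0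
    rw [zero_add] at this
    exact this.symm
  have hus0 : u lam s = γ s := by rw [hu0]
  -- Differentiate in λ the identity stating that u λ s returns to itself after time m P(λ).
  have hv : (Y τ ^ m - 1 : Phase n →L[ℝ] Phase n) v + (m * p') • f (γ 0) = 0 := by
    set P := fun w : Phase n × ℝ × ℝ => trajectory X f g (l * w.2.1) w.1 w.2.1 w.2.2 with hPdef
    have hP : HasFDerivAt P (fderiv ℝ P (γ s, T₀, 0)) (u lam s, m * p lam / l, 0) := by
      rw [hus0, hp0, ← hlT, mul_div_cancel_left₀ _ hl.ne']
      exact ((S.endpoint_properties hγ hl hT₀ s).2.1.differentiableAt S.cast_ne_zero).hasFDerivAt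
    have h4 : HasDerivAt (fun a => ((u a s, m * p a / l, 0) : Phase n × ℝ × ℝ))
        (Y s v, m * p' / l, 0) lam :=
      hus.prodMk (((hpd.const_mul _).div_const l).prodMk (hasDerivAt_const _ _))
    have h5 := HasFDerivAt.comp_hasDerivAt (l := P) lam hP h4
    rw [S.fderiv_endpoint hγ hY hl hT₀ hlT, mul_div_cancel₀ _ hl.ne'] at h5
    have h6 : Y s ((Y τ ^ m) v) + (m * p') • f (γ s) = Y s v := by
      refine h5.unique (hus.congr_of_eventuallyEq ?_)
      filter_upwards [hfam] with a ha
      have hpa := ha.1.period_pos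
      have h7 : 0 < m * p a := by positivity
      simp only [Function.comp, hPdef]
      rw [mul_div_cancel₀ _ hl.ne', S.trajectory_periodicOrbit ha.1 (div_pos h7 hl) h7.le,
        ha.1.periodic_nat]
    apply hinj
    rw [map_add, map_smul, hf0, map_zero]
    change Y s ((Y τ ^ m) v - v) + _ = _
    rw [map_sub, sub_add_eq_add_sub, h6, sub_self]
  have hLs : HasFDerivAt L (fderiv ℝ L (γ s, m * τ)) (γ s, m * τ) := (hLd s).hasFDerivAt
  let φ : Phase n × ℝ →ₗ[ℝ] ℝ := ((fderiv ℝ L (γ s, m * τ)).comp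
    ((Y s).prodMap (ContinuousLinearMap.id ℝ ℝ)) : Phase n × ℝ →L[ℝ] ℝ)
  have hφ : ∀ x d, φ (x, d) = fderiv ℝ L (γ s, m * τ) (Y s x, d) := fun x d => rfl
  have hφ0 : φ (f (γ 0), 0) = 0 := by
    rw [hφ, hf0]
    have h4 : HasDerivAt (fun t => ((γ t, m * τ) : Phase n × ℝ)) (f (γ s), 0) s :=
      (hγ.hasDerivAt s).prodMk (hasDerivAt_const _ _)
    have h5 := HasFDerivAt.comp_hasDerivAt (l := L) s hLs h4
    have h6 : L ∘ (fun t => ((γ t, m * τ) : Phase n × ℝ)) = fun _ => lam := by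
      ext t
      have := hfam.self_of_nhds.2 t
      rwa [hu0, hp0] at this
    rw [h6] at h5
    exact h5.unique (hasDerivAt_const _ _)
  -- The derivative of L(u λ s, m P(λ)) = λ.
  have hφv : φ (v, m * p') = 1 := by
    rw [hφ]
    have h4 : HasDerivAt (fun a => ((u a s, m * p a) : Phase n × ℝ)) (Y s v, m * p') lam :=
      hus.prodMk (hpd.const_mul _)
    have hLs' : HasFDerivAt L (fderiv ℝ L (γ s, m * τ)) (u lam s, m * p lam) := by
      rwa [hus0, hp0]
    have h5 := HasFDerivAt.comp_hasDerivAt (l := L) lam hLs' h4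
    refine h5.unique ((hasDerivAt_id lam).congr_of_eventuallyEq ?_)
    filter_upwards [hfam] with a ha
    exact ha.2 s
  have hYf : (Y τ ^ m) (f (γ 0)) = f (γ 0) := by
    have h4 := hγ.variational_add_period S.isOpen hf1 hY m (f (γ 0)) 0
    rw [hγ.variational_apply_field S.isOpen hf1 hY, hγ.periodic_nat, hY.1] at h4
    exact h4.symm
  obtain ⟨hc, a, ha⟩ := exists_smul_eq_of_normal
    (A := ((Y τ ^ m - 1 : Phase n →L[ℝ] Phase n) : Phase n →ₗ[ℝ] Phase n))
    (hγ.field_ne_zero S.isOpen hf1 0) (sub_eq_zero.2 hYf) hker hφ0 hv hφv hη h2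
  have hc0 : c = 0 := (mul_eq_zero.1 hc).resolve_left hl.ne'
  -- Now η is a multiple of f(γ s), and the phase condition makes it zero.
  rw [← ha, map_smul, hf0, inner_smul_left] at h3
  have ha0 : a = 0 := by
    refine (mul_eq_zero.1 h3).resolve_right ?_
    exact inner_self_ne_zero.2 (hγ.field_ne_zero S.isOpen hf1 s)
  refine ⟨?_, hc0, rfl⟩
  rw [← ha, ha0, zero_smul, map_zero]

theorem partial_injective (S : IsRegularSystem X f H g εmax k)
    (hγ : IsPeriodicOrbit X f γ τ) {l T₀ : ℝ} {m : ℕ} (hl : 0 < l) (hT₀ : 0 < T₀)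
    (hlT : l * T₀ = m * τ) (hm : 0 < m) (hDH : fderiv ℝ H (γ 0) ≠ 0) (hnormal : IsMNormal f γ τ m)
    {L : Phase n × ℝ → ℝ} (hLd : ∀ t, DifferentiableAt ℝ L (γ t, m * τ))
    (hL : ParametrisesFamily X f γ τ m L) (s : ℝ) :
    fderiv ℝ H (γ s) ≠ 0 ∧
    ∀ (η : Phase n) (c μ : ℝ),
      fderiv ℝ (fun w : Phase n × ℝ × ℝ => trajectory X f g (l * w.2.1) w.1 w.2.1 w.2.2)
        (γ s, T₀, 0) (η, c, 0) - η - μ • gradient H (γ s) = 0 →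
      fderiv ℝ L (γ s, m * τ) (η, l * c) = 0 → inner ℝ η (f (γ s)) = 0 →
      η = 0 ∧ c = 0 ∧ μ = 0 := by
  obtain ⟨j, hj⟩ := exists_nat_gt (-s / τ)
  have hs : 0 < s + j * τ := by
    rw [div_lt_iff₀ hγ.period_pos] at hj
    linarith
  have := S.partial_injective_of_pos hγ hl hT₀ hlT hm hDH hnormal hLd hL hs
  rwa [hγ.periodic_nat] at this

end IsRegularSystem

/-! ### Uniformity along closed curves -/

section PeriodicCompactness

variable {τ : ℝ}

/-- A periodic family of conditions that hold locally with some radius hold with one radius. -/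
theorem exists_uniform_radius (hτ : 0 < τ) {Q : ℝ → ℝ → Prop}
    (mono : ∀ s ρ ρ', 0 < ρ → ρ ≤ ρ' → Q s ρ' → Q s ρ) (per : ∀ s ρ, Q (s + τ) ρ ↔ Q s ρ)
    (loc : ∀ s₀, ∃ ρ > 0, ∀ᶠ s in 𝓝 s₀, Q s ρ) : ∃ ρ > 0, ∀ s, Q s ρ := by
  have h : ∃ ρ > 0, ∀ s ∈ Icc 0 τ, Q s ρ := by
    refine isCompact_Icc.induction_on (p := fun S => ∃ ρ > 0, ∀ s ∈ S, Q s ρ)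
      ⟨1, one_pos, by simp⟩ (fun S S' hS ⟨ρ, hρ, h⟩ => ⟨ρ, hρ, fun s hs => h s (hS hs)⟩) ?_ ?_
    · rintro S S' ⟨ρ, hρ, h⟩ ⟨ρ', hρ', h'⟩
      refine ⟨min ρ ρ', lt_min hρ hρ', fun s hs => ?_⟩
      rcases hs with hs | hs
      · exact mono s _ _ (lt_min hρ hρ') (min_le_left _ _) (h s hs)
      · exact mono s _ _ (lt_min hρ hρ') (min_le_right _ _) (h' s hs)
    · intro s _
      obtain ⟨ρ, hρ, h⟩ := loc s
      exact ⟨_, mem_nhdsWithin_of_mem_nhds h, ρ, hρ, fun s hs => hs⟩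
  obtain ⟨ρ, hρ, h⟩ := h
  refine ⟨ρ, hρ, fun s => ?_⟩
  have hp : Function.Periodic (fun s => Q s ρ) τ := fun s => propext (per s ρ)
  obtain ⟨s', hs', he⟩ := hp.exists_mem_Ico₀ hτ s
  exact (iff_of_eq he).2 (h s' (Ico_subset_Icc_self hs'))

theorem exists_uniform_nhds {A : Type*} [NormedAddCommGroup A] (hτ : 0 < τ)
    {R : ℝ → A → Prop} (per : ∀ s a, R (s + τ) a ↔ R s a)
    (loc : ∀ s₀, ∀ᶠ q : ℝ × A in 𝓝 (s₀, 0), R q.1 q.2) :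
    ∃ ρ > 0, ∀ s a, ‖a‖ < ρ → R s a := by
  refine exists_uniform_radius hτ (Q := fun s ρ => ∀ a, ‖a‖ < ρ → R s a)
    (fun s ρ ρ' _ hle h a ha => h a (ha.trans_le hle)) (fun s ρ => by simp only [per]) fun s₀ => ?_
  obtain ⟨r, hr, h⟩ := Metric.eventually_nhds_iff_ball.1 (loc s₀)
  refine ⟨r, hr, ?_⟩
  filter_upwards [Metric.ball_mem_nhds s₀ hr] with s hs a ha
  refine h (s, a) ?_
  rw [← ball_prod_same]
  exact ⟨hs, by simpa using ha⟩

/-- Conditions that hold near each point of a periodic curve hold in a uniform neighbourhood. -/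
theorem exists_uniform_nhds_curve {E : Type*} [NormedAddCommGroup E] (hτ : 0 < τ)
    {y₀ : ℝ → E} (hy : Continuous y₀) (hyp : ∀ s, y₀ (s + τ) = y₀ s) {R : ℝ → ℝ → E → Prop}
    (per : ∀ s ε y, R (s + τ) ε y ↔ R s ε y)
    (loc : ∀ s₀, ∀ᶠ q : (ℝ × ℝ) × E in 𝓝 ((s₀, 0), y₀ s₀), R q.1.1 q.1.2 q.2) :
    ∃ ρ > 0, ∀ s ε y, |ε| < ρ → ‖y - y₀ s‖ < ρ → R s ε y := by
  obtain ⟨ρ, hρ, h⟩ := exists_uniform_nhds hτ (A := ℝ × E)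
    (R := fun s a => R s a.1 (y₀ s + a.2)) (fun s a => by rw [hyp, per]) fun s₀ => by
      have ht : Tendsto (fun q : ℝ × ℝ × E => ((q.1, q.2.1), y₀ q.1 + q.2.2)) (𝓝 (s₀, 0))
          (𝓝 ((s₀, 0), y₀ s₀)) := by
        refine Continuous.tendsto' (by fun_prop) _ _ ?_
        simp
      exact ht.eventually (loc s₀)
  refine ⟨ρ, hρ, fun s ε y hε hy => ?_⟩
  have := h s (ε, y - y₀ s) (max_lt hε hy)
  simpa using this

theorem exists_uniform_linear_bound {G : Type*} [NormedAddCommGroup G] [NormedSpace ℝ G]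
    (hτ : 0 < τ) {F : ℝ × ℝ → G} (hF : ∀ s, ContDiffAt ℝ 1 F (s, 0))
    (hp : ∃ r > 0, ∀ s ε, |ε| < r → F (s + τ, ε) = F (s, ε)) :
    ∃ ρ > 0, ∀ s ε, |ε| < ρ → ‖F (s, ε) - F (s, 0)‖ ≤ ρ⁻¹ * |ε| := by
  obtain ⟨r, hr, hp⟩ := hp
  obtain ⟨ρ, hρ, h⟩ := exists_uniform_radius hτ
    -- A single number serves as radius and, inverted, as constant, so that shrinking it weakens the
    -- condition. The cap r stays where F is known to be periodic.
    (Q := fun s ρ => ∀ ε, |ε| < min ρ r → ‖F (s, ε) - F (s, 0)‖ ≤ ρ⁻¹ * |ε|)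
    (fun s ρ ρ' hρ hle h ε hε => (h ε (hε.trans_le (min_le_min_right _ hle))).trans (by gcongr))
    (fun s ρ => by
      refine forall_congr' fun ε => imp_congr_right fun hε => ?_
      rw [hp s ε (hε.trans_le (min_le_right _ _)), hp s 0 (by simpa using hr)])
    fun s₀ => by
      obtain ⟨K, t, ht, hK⟩ := (hF s₀).exists_lipschitzOnWith
      obtain ⟨d, hd, hb⟩ := Metric.mem_nhds_iff.1 ht
      refine ⟨min d (K + 1)⁻¹, by positivity, ?_⟩
      filter_upwards [Metric.ball_mem_nhds s₀ hd] with s hs ε hε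
      have hmem : ∀ ε, |ε| < d → (s, ε) ∈ t := fun ε hε => hb (by
        rw [← ball_prod_same]
        exact ⟨hs, by simpa using hε⟩)
      have h1 := hK.norm_sub_le (hmem ε (hε.trans_le ((min_le_left _ _).trans (min_le_left _ _))))
        (hmem 0 (by simpa using hd))
      refine h1.trans ?_
      have h2 : ‖((s, ε) : ℝ × ℝ) - (s, 0)‖ = |ε| := by
        simp [Prod.norm_def]
      rw [h2]
      refine mul_le_mul_of_nonneg_right ?_ (abs_nonneg ε)
      have hK0 : (0 : ℝ) < K + 1 := by positivity
      have h3 : ((K : ℝ) + 1) ≤ (min d (K + 1 : ℝ)⁻¹)⁻¹ := by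
        rw [le_inv_comm₀ hK0 (by positivity)]
        exact min_le_right _ _
      linarith
  refine ⟨min ρ r, lt_min hρ hr, fun s ε hε => (h s ε hε).trans ?_⟩
  gcongr
  exact min_le_left _ _

/-- A periodic family of implicit functions along a periodic curve of nondegenerate zeros. -/
theorem exists_periodic_implicitFunction {E : Type*} [NormedAddCommGroup E] [NormedSpace ℝ E]
    [FiniteDimensional ℝ E] (hτ : 0 < τ) {k : ℕ} (hk : k ≠ 0) {y₀ : ℝ → E} (hy : Continuous y₀)
    (hyp : ∀ s, y₀ (s + τ) = y₀ s) {K : (ℝ × ℝ) × E → E}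
    (hKp : ∀ s ε y, K ((s + τ, ε), y) = K ((s, ε), y))
    (hK : ∀ s, ContDiffAt ℝ k K ((s, 0), y₀ s)) (hK0 : ∀ s, K ((s, 0), y₀ s) = 0)
    (hinj : ∀ s v, fderiv ℝ K ((s, 0), y₀ s) (0, v) = 0 → v = 0) {ρ₀ : ℝ} (hρ₀ : 0 < ρ₀) :
    ∃ (Ψ : ℝ × ℝ → E) (ρ ε₁ : ℝ), 0 < ρ ∧ ρ ≤ ρ₀ ∧ 0 < ε₁ ∧
      (∀ s ε, |ε| < ε₁ → ContDiffAt ℝ k Ψ (s, ε) ∧ K ((s, ε), Ψ (s, ε)) = 0 ∧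
        ‖Ψ (s, ε) - y₀ s‖ < ρ ∧ Ψ (s + τ, ε) = Ψ (s, ε)) ∧
      ∀ s ε y, |ε| < ε₁ → ‖y - y₀ s‖ < ρ → K ((s, ε), y) = 0 → y = Ψ (s, ε) := by
  have : CompleteSpace E := FiniteDimensional.complete ℝ E
  have hk' : ((k : ℕ) : WithTop ℕ∞) ≠ 0 := by exact_mod_cast hk
  have hinv : ∀ s, (fderiv ℝ K ((s, 0), y₀ s) ∘L .inr ℝ (ℝ × ℝ) E).IsInvertible := fun s => by
    have hi : Function.Injective
        ((fderiv ℝ K ((s, 0), y₀ s) ∘L .inr ℝ (ℝ × ℝ) E : E →L[ℝ] E) : E →ₗ[ℝ] E) := by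
      rw [injective_iff_map_eq_zero]
      exact fun v hv => hinj s v hv
    exact ⟨(LinearEquiv.ofInjectiveEndo _ hi).toContinuousLinearEquiv, by ext; rfl⟩
  -- Uniqueness is a statement about pairs of zeros, so compactness is applied along the doubled
  -- curve (y₀, y₀).
  obtain ⟨ρ₁, hρ₁, huniq⟩ := exists_uniform_nhds_curve hτ (y₀ := fun s => (y₀ s, y₀ s))
    (by fun_prop) (fun s => by rw [hyp])
    (R := fun s ε y => K ((s, ε), y.1) = 0 → K ((s, ε), y.2) = 0 → y.1 = y.2)
    (fun s ε y => by rw [hKp, hKp]) fun s₀ => by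
      have h := (hK s₀).eventually_apply_eq_iff_implicitFunction hk' (hinv s₀)
      rw [hK0] at h
      have h1 : Tendsto (fun q : (ℝ × ℝ) × E × E => (q.1, q.2.1)) (𝓝 ((s₀, 0), y₀ s₀, y₀ s₀))
          (𝓝 ((s₀, 0), y₀ s₀)) := Continuous.tendsto' (by fun_prop) _ _ rfl
      have h2 : Tendsto (fun q : (ℝ × ℝ) × E × E => (q.1, q.2.2)) (𝓝 ((s₀, 0), y₀ s₀, y₀ s₀))
          (𝓝 ((s₀, 0), y₀ s₀)) := Continuous.tendsto' (by fun_prop) _ _ rfl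
      filter_upwards [h1.eventually h, h2.eventually h] with q hq1 hq2 h3 h4
      exact (hq1.1 h3).symm.trans (hq2.1 h4)
  let ρ := min ρ₀ ρ₁
  have hρ : 0 < ρ := lt_min hρ₀ hρ₁
  -- Existence is stated for a local solution branch that depends on the point, which makes it
  -- invariant under s ↦ s + τ.
  obtain ⟨ρ₂, hρ₂, hex⟩ := exists_uniform_nhds hτ (A := ℝ)
    (R := fun s ε => ∃ ψ : ℝ × ℝ → E, ContDiffAt ℝ k ψ (s, ε) ∧ ∀ᶠ q : ℝ × ℝ in 𝓝 (s, ε),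
      K (q, ψ q) = 0 ∧ ‖ψ q - y₀ q.1‖ < ρ)
    (fun s ε => by
      have hshift : ∀ (a s ε : ℝ), Tendsto (fun q : ℝ × ℝ => (q.1 + a, q.2)) (𝓝 (s, ε))
          (𝓝 (s + a, ε)) := fun a s ε => Continuous.tendsto' (by fun_prop) _ _ rfl
      constructor
      · rintro ⟨ψ, h1, h2⟩
        refine ⟨fun q => ψ (q.1 + τ, q.2), ?_, ?_⟩
        · exact ContDiffAt.comp (g := ψ) (f := fun q : ℝ × ℝ => (q.1 + τ, q.2)) _ h1
            (by fun_prop)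
        · filter_upwards [(hshift τ s ε).eventually h2] with q hq
          rwa [hKp, hyp] at hq
      · rintro ⟨ψ, h1, h2⟩
        have h3 := hshift (-τ) (s + τ) ε
        rw [add_neg_cancel_right] at h3
        refine ⟨fun q => ψ (q.1 + -τ, q.2), ?_, ?_⟩
        · refine ContDiffAt.comp (g := ψ) (f := fun q : ℝ × ℝ => (q.1 + -τ, q.2)) _ ?_
            (by fun_prop)
          simpa using h1
        · filter_upwards [h3.eventually h2] with q hq
          rwa [← hKp, ← hyp, neg_add_cancel_right] at hq) fun s₀ => by
      let ψ := (hK s₀).implicitFunction hk' (hinv s₀)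
      have hψ : ContDiffAt ℝ k ψ (s₀, 0) := (hK s₀).contDiffAt_implicitFunction hk' (hinv s₀)
      have hψ0 : ψ (s₀, 0) = y₀ s₀ := (hK s₀).implicitFunction_apply_self hk' (hinv s₀)
      have h1 : ∀ᶠ q in 𝓝 (s₀, (0 : ℝ)), K (q, ψ q) = 0 := by
        have := (hK s₀).eventually_apply_implicitFunction hk' (hinv s₀)
        rwa [hK0] at this
      have h2 : ∀ᶠ q : ℝ × ℝ in 𝓝 (s₀, (0 : ℝ)), ‖ψ q - y₀ q.1‖ < ρ := by
        have h3 : ContinuousAt (fun q : ℝ × ℝ => ‖ψ q - y₀ q.1‖) (s₀, 0) :=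
          (hψ.continuousAt.sub (hy.continuousAt.comp continuousAt_fst)).norm
        refine h3.eventually_lt continuousAt_const ?_
        simpa [hψ0] using hρ
      filter_upwards [(h1.and h2).eventually_nhds, hψ.eventually (by simp)] with q hq1 hq2
      exact ⟨ψ, hq2, hq1⟩
  classical
  -- The only zero within ρ, so Ψ agrees with every local branch; smoothness and periodicity follow
  -- without gluing.
  let Ψ : ℝ × ℝ → E := fun q =>
    if h : ∃ y, ‖y - y₀ q.1‖ < ρ ∧ K (q, y) = 0 then h.choose else 0
  have hΨ : ∀ s ε y, |ε| < min ρ₁ ρ₂ → ‖y - y₀ s‖ < ρ → K ((s, ε), y) = 0 →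
      y = Ψ (s, ε) ∧ ‖Ψ (s, ε) - y₀ s‖ < ρ ∧ K ((s, ε), Ψ (s, ε)) = 0 := by
    intro s ε y hε hy1 hy2
    have h : ∃ y, ‖y - y₀ (s, ε).1‖ < ρ ∧ K ((s, ε), y) = 0 := ⟨y, hy1, hy2⟩
    have hdef : Ψ (s, ε) = h.choose := dif_pos h
    rw [hdef]
    refine ⟨huniq s ε (y, h.choose) (hε.trans_le (min_le_left _ _))
      (max_lt (hy1.trans_le (min_le_right _ _)) (h.choose_spec.1.trans_le (min_le_right _ _)))
      hy2 h.choose_spec.2, h.choose_spec⟩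
  refine ⟨Ψ, ρ, min ρ₁ ρ₂, hρ, min_le_left _ _, lt_min hρ₁ hρ₂, fun s ε hε => ?_,
    fun s ε y hε hy1 hy2 => (hΨ s ε y hε hy1 hy2).1⟩
  obtain ⟨ψ, hψ, hψe⟩ := hex s ε (hε.trans_le (min_le_right _ _))
  have h0 := hψe.self_of_nhds
  have hs := hΨ s ε _ hε h0.2 h0.1
  refine ⟨?_, hs.2.2, hs.2.1, ?_⟩
  · refine hψ.congr_of_eventuallyEq ?_
    have h1 : ∀ᶠ q : ℝ × ℝ in 𝓝 (s, ε), |q.2| < min ρ₁ ρ₂ :=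
      (continuous_snd.abs.continuousAt (x := (s, ε))).eventually_lt continuousAt_const hε
    filter_upwards [hψe, h1] with q hq hq2
    exact (hΨ q.1 q.2 _ hq2 hq.2 hq.1).1.symm
  · refine ((hΨ (s + τ) ε (Ψ (s, ε)) hε ?_ ?_).1).symm
    · rw [hyp]; exact hs.2.1
    · rw [hKp]; exact hs.2.2

theorem isInvertible_comp_inr_of_ne_zero {E : Type*} [NormedAddCommGroup E] [NormedSpace ℝ E]
    {φ : E × ℝ →L[ℝ] ℝ} (h : φ (0, 1) ≠ 0) : (φ ∘L .inr ℝ E ℝ).IsInvertible := by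
  have hi : Function.Injective ((φ ∘L .inr ℝ E ℝ : ℝ →L[ℝ] ℝ) : ℝ →ₗ[ℝ] ℝ) := by
    rw [injective_iff_map_eq_zero]
    intro c hc
    have h1 : ((0, c) : E × ℝ) = c • (0, 1) := by simp
    have h2 : φ (0, c) = 0 := hc
    rw [h1, map_smul, smul_eq_mul] at h2
    exact (mul_eq_zero.1 h2).resolve_right h
  exact ⟨(LinearEquiv.ofInjectiveEndo _ hi).toContinuousLinearEquiv, by ext; rfl⟩

/-- Uniqueness of the foot point, modulo the period, near a closed curve. -/
theorem exists_foot_unique {E : Type*} [NormedAddCommGroup E] [InnerProductSpace ℝ E]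
    (hτ : 0 < τ) {γ w : ℝ → E} (hγ : ∀ t, HasDerivAt γ (w t) t)
    (hγ1 : ContDiff ℝ 1 γ) (hw : ContDiff ℝ 1 w) (hw0 : ∀ t, w t ≠ 0)
    (hp : ∀ t, γ (t + τ) = γ t) (hwp : ∀ t, w (t + τ) = w t)
    (hinj : ∀ s t, s < t → t < s + τ → γ t ≠ γ s) [CompleteSpace E] :
    ∃ ρ > 0, ∀ s s' ξ, ‖ξ - γ s‖ < ρ → ‖ξ - γ s'‖ < ρ → inner ℝ (ξ - γ s) (w s) = 0 →
      inner ℝ (ξ - γ s') (w s') = 0 → ∃ j : ℤ, s' = s + j * τ := by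
  have hpz : ∀ (j : ℤ) t, γ (t + j * τ) = γ t := fun j t =>
    (show Function.Periodic γ τ from hp).int_mul j t
  have hwpz : ∀ (j : ℤ) t, w (t + j * τ) = w t := fun j t =>
    (show Function.Periodic w τ from hwp).int_mul j t
  refine exists_uniform_radius hτ (Q := fun s ρ => ∀ s' ξ, ‖ξ - γ s‖ < ρ → ‖ξ - γ s'‖ < ρ →
      inner ℝ (ξ - γ s) (w s) = 0 → inner ℝ (ξ - γ s') (w s') = 0 → ∃ j : ℤ, s' = s + j * τ)
    (fun s ρ ρ' _ hle h s' ξ h1 h2 => h s' ξ (h1.trans_le hle) (h2.trans_le hle))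
    (fun s ρ => ?_) fun s₀ => ?_
  · have hj : ∀ s', (∃ j : ℤ, s' = s + τ + j * τ) ↔ ∃ j : ℤ, s' = s + j * τ := fun s' =>
      ⟨fun ⟨j, hj⟩ => ⟨j + 1, by push_cast; linarith⟩,
        fun ⟨j, hj⟩ => ⟨j - 1, by push_cast; linarith⟩⟩
    simp only [hp, hwp, hj]
  · let ψ : E × ℝ → ℝ := fun q => inner ℝ (q.1 - γ q.2) (w q.2)
    have hψ : ContDiff ℝ 1 ψ :=
      (contDiff_fst.sub (hγ1.comp contDiff_snd)).inner ℝ (hw.comp contDiff_snd)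
    have hψ0 : ψ (γ s₀, s₀) = 0 := by simp [ψ]
    -- Differentiating the phase condition in s gives -‖w s₀‖² ≠ 0, so the foot is locally an
    -- implicit function of ξ.
    have hpart : fderiv ℝ ψ (γ s₀, s₀) (0, 1) = -inner ℝ (w s₀) (w s₀) := by
      have h1 : HasDerivAt (fun s : ℝ => ((γ s₀, s) : E × ℝ)) (0, 1) s₀ :=
        (hasDerivAt_const _ _).prodMk (hasDerivAt_id _)
      have h2 := ((hψ.differentiable one_ne_zero _).hasFDerivAt).comp_hasDerivAt s₀ h1
      have h3 : HasDerivAt (fun s => inner ℝ (γ s₀ - γ s) (w s))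
          (inner ℝ (γ s₀ - γ s₀) (deriv w s₀) + inner ℝ (-w s₀) (w s₀)) s₀ :=
        ((hγ s₀).const_sub _).inner ℝ (hw.differentiable one_ne_zero s₀).hasDerivAt
      rw [sub_self, inner_zero_left, zero_add, inner_neg_left] at h3
      exact h2.unique h3
    have hinv : (fderiv ℝ ψ (γ s₀, s₀) ∘L .inr ℝ E ℝ).IsInvertible := by
      refine isInvertible_comp_inr_of_ne_zero ?_
      rw [hpart]
      exact neg_ne_zero.2 (inner_self_ne_zero.2 (hw0 s₀))
    have hloc := hψ.contDiffAt.eventually_apply_eq_iff_implicitFunction one_ne_zero hinv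
    rw [hψ0] at hloc
    obtain ⟨δ, hδ, hδb⟩ := Metric.eventually_nhds_iff_ball.1 hloc
    -- Over one period and away from s₀ and s₀ + τ, the curve keeps a positive distance d from γ s₀.
    -- Hence a foot whose orbit point is within d of γ s₀ has a translate near s₀.
    have hCc : IsCompact (Icc s₀ (s₀ + τ) \ (Metric.ball s₀ δ ∪ Metric.ball (s₀ + τ) δ)) :=
      isCompact_Icc.diff (Metric.isOpen_ball.union Metric.isOpen_ball)
    have hnot : γ s₀ ∉ γ '' (Icc s₀ (s₀ + τ) \ (Metric.ball s₀ δ ∪ Metric.ball (s₀ + τ) δ)) := by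
      rintro ⟨t, ⟨ht, ht'⟩, he⟩
      refine hinj s₀ t (lt_of_le_of_ne ht.1 ?_) (lt_of_le_of_ne ht.2 ?_) he
      · rintro rfl
        exact ht' (Or.inl (Metric.mem_ball_self hδ))
      · rintro rfl
        exact ht' (Or.inr (Metric.mem_ball_self hδ))
    obtain ⟨d, hd, hdb⟩ := Metric.mem_nhds_iff.1
      ((hCc.image hγ1.continuous).isClosed.isOpen_compl.mem_nhds hnot)
    let ρ := min δ d / 3
    have hρ : 0 < ρ := by positivity
    have hρδ : 3 * ρ ≤ δ := by
      have := min_le_left δ d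
      simp only [ρ]; linarith
    have hρd : 3 * ρ ≤ d := by
      have := min_le_right δ d
      simp only [ρ]; linarith
    refine ⟨ρ, hρ, ?_⟩
    have hnear : ∀ᶠ s in 𝓝 s₀, dist (γ s) (γ s₀) < ρ :=
      (Metric.tendsto_nhds.1 hγ1.continuous.continuousAt) ρ hρ
    filter_upwards [Metric.ball_mem_nhds s₀ hδ, hnear] with s hs hsγ s' ξ h1 h2 h3 h4
    rw [← dist_eq_norm] at h1 h2
    have hξ : dist ξ (γ s₀) < δ := by
      have := dist_triangle ξ (γ s) (γ s₀)
      linarith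
    have hs'd : dist (γ s') (γ s₀) < d := by
      have h5 := dist_triangle (γ s') ξ (γ s₀)
      have h6 := dist_triangle ξ (γ s) (γ s₀)
      rw [dist_comm (γ s') ξ] at h5
      linarith
    have hj : ∃ j : ℤ, dist (s' + j * τ) s₀ < δ := by
      obtain ⟨j, hj, -⟩ := existsUnique_add_zsmul_mem_Ico hτ s' s₀
      rw [zsmul_eq_mul] at hj
      have h7 : γ (s' + j * τ) ∈ Metric.ball (γ s₀) d := by
        rw [hpz]
        exact hs'd
      have h8 := hdb h7
      by_cases h9 : s' + j * τ ∈ Metric.ball s₀ δ ∪ Metric.ball (s₀ + τ) δ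
      · rcases h9 with h9 | h9
        · exact ⟨j, h9⟩
        · refine ⟨j - 1, ?_⟩
          rw [Metric.mem_ball, Real.dist_eq] at h9
          rw [Real.dist_eq]
          have : s' + ((j - 1 : ℤ) : ℝ) * τ - s₀ = s' + j * τ - (s₀ + τ) := by push_cast; ring
          rwa [this]
      · exact (h8 ⟨_, ⟨Ico_subset_Icc_self hj, h9⟩, rfl⟩).elim
    obtain ⟨j, hj⟩ := hj
    have hz1 := (hδb (ξ, s) (by rw [← ball_prod_same]; exact ⟨hξ, hs⟩)).1 h3
    have hz2 := (hδb (ξ, s' + j * τ) (by rw [← ball_prod_same]; exact ⟨hξ, hj⟩)).1 (by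
      simp only [ψ, hpz, hwpz]
      exact h4)
    refine ⟨-j, ?_⟩
    -- Both s and s' + jτ equal the implicit function at ξ.
    have h10 := hz1.symm.trans hz2
    push_cast
    linarith

end PeriodicCompactness

/-! ### The augmented displacement problem and the reduction -/

theorem fderiv_apply_eq_inner_gradient {E : Type*} [NormedAddCommGroup E] [InnerProductSpace ℝ E]
    [CompleteSpace E] (H : E → ℝ) (x v : E) :
    fderiv ℝ H x v = inner ℝ (gradient H x) v :=
  InnerProductSpace.toDual_symm_apply.symm

namespace IsPeriodicOrbit

variable {n : ℕ} {X : Set (Phase n)} {f : Phase n → Phase n} {γ : ℝ → Phase n} {τ : ℝ}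

theorem contDiff (hγ : IsPeriodicOrbit X f γ τ) {k : ℕ} (hf : ContDiffOn ℝ k f X) :
    ContDiff ℝ k γ := by
  have h : ∀ j ≤ k, ContDiff ℝ j γ := by
    intro j
    induction j with
    | zero => exact fun _ => contDiff_zero.2 hγ.continuous
    | succ j ih =>
      intro hj
      rw [Nat.cast_add, Nat.cast_one, contDiff_succ_iff_deriv]
      refine ⟨fun t => (hγ.hasDerivAt t).differentiableAt, by simp, ?_⟩
      have hd : deriv γ = f ∘ γ := funext fun t => (hγ.hasDerivAt t).deriv
      rw [hd]
      exact (hf.of_le (by exact_mod_cast (Nat.le_succ j).trans hj)).comp_contDiff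
        (ih ((Nat.le_succ j).trans hj)) hγ.mem
  exact h k le_rfl

end IsPeriodicOrbit

namespace IsRegularSystem

variable {n : ℕ} {X : Set (Phase n)} {f : Phase n → Phase n} {H : Phase n → ℝ}
  {g : Phase n → ℝ → ℝ → ℝ → Phase n} {εmax : ℝ} {k : ℕ} {γ : ℝ → Phase n} {τ : ℝ}

theorem contDiff_gradient_orbit (S : IsRegularSystem X f H g εmax k)
    (hγ : IsPeriodicOrbit X f γ τ) : ContDiff ℝ k (fun s => gradient H (γ s)) := by
  let b := EuclideanSpace.basisFun (Fin n) ℝ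
  have h1 : (fun s => gradient H (γ s)) = fun s => ∑ i, fderiv ℝ H (γ s) (b i) • b i := by
    ext1 s
    rw [← b.sum_repr' (gradient H (γ s))]
    refine Finset.sum_congr rfl fun i _ => ?_
    rw [fderiv_apply_eq_inner_gradient, real_inner_comm]
  rw [h1]
  have h2 : ContDiff ℝ k (fun s => fderiv ℝ H (γ s)) :=
    S.fderiv_H_contDiffOn.comp_contDiff (hγ.contDiff S.f_contDiffOn) hγ.mem
  exact ContDiff.sum fun i _ => (h2.clm_apply contDiff_const).smul contDiff_const

theorem exists_uniform_foot (S : IsRegularSystem X f H g εmax k)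
    (hγ : IsPeriodicOrbit X f γ τ) :
    ∃ ρ > 0, ∀ s s' ξ, ‖ξ - γ s‖ < ρ → ‖ξ - γ s'‖ < ρ → inner ℝ (ξ - γ s) (f (γ s)) = 0 →
      inner ℝ (ξ - γ s') (f (γ s')) = 0 → ∃ j : ℤ, s' = s + j * τ := by
  have hγ1 := (hγ.contDiff S.f_contDiffOn).of_le S.one_le
  refine exists_foot_unique hγ.period_pos hγ.hasDerivAt hγ1
    ((S.f_contDiffOn.of_le S.one_le).comp_contDiff hγ1 hγ.mem)
    (hγ.field_ne_zero S.isOpen (S.f_contDiffOn.of_le S.one_le)) hγ.periodic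
    (fun t => by rw [hγ.periodic]) fun s t hst hts he => ?_
  -- Minimality of τ is stated at time 0 only, so a coincidence γ t = γ s is carried forward until s
  -- reaches a multiple of τ.
  obtain ⟨j, hj⟩ := exists_nat_gt (s / τ)
  rw [div_lt_iff₀ hγ.period_pos] at hj
  have hb : 0 ≤ j * τ - s := by linarith
  have h1 := S.trajectory_periodicOrbit hγ one_pos hb s
  have h2 := S.trajectory_periodicOrbit hγ one_pos hb t
  rw [he, h1] at h2
  refine hγ.minimal (t - s) (by linarith) (by linarith) ?_
  have h3 := hγ.periodic_nat j (t - s)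
  have h4 := hγ.periodic_nat j 0
  rw [← h3, ← h4]
  convert h2.symm using 2 <;> ring

/-- `H` is strictly monotone along its gradient near the orbit. -/
theorem eventually_H_add_gradient (S : IsRegularSystem X f H g εmax k)
    (hγ : IsPeriodicOrbit X f γ τ) {s₀ : ℝ} (hDH : fderiv ℝ H (γ s₀) ≠ 0) :
    ∀ᶠ q : (ℝ × Phase n) × ℝ in 𝓝 ((s₀, γ s₀), 0),
      H (q.1.2 + q.2 • gradient H (γ q.1.1)) = H q.1.2 → q.2 = 0 := by
  set ν := gradient H (γ s₀) with hν
  let G : (ℝ × Phase n) × ℝ → ℝ := fun q => H (q.1.2 + q.2 • gradient H (γ q.1.1)) - H q.1.2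
  have hH : ContDiffAt ℝ 1 H (γ s₀) :=
    (S.H_contDiffOn.contDiffAt (S.isOpen.mem_nhds (hγ.mem s₀))).of_le (by norm_cast; omega)
  have hν1 := (S.contDiff_gradient_orbit hγ).of_le S.one_le
  have hG : ContDiffAt ℝ 1 G ((s₀, γ s₀), 0) := by
    refine ContDiffAt.sub ?_ ?_
    · refine ContDiffAt.comp (g := H)
        (f := fun q : (ℝ × Phase n) × ℝ => q.1.2 + q.2 • gradient H (γ q.1.1)) _ ?_ ?_
      · simpa using hH
      · refine ContDiff.contDiffAt ?_
        exact (contDiff_snd.comp contDiff_fst).add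
          (contDiff_snd.smul (hν1.comp (contDiff_fst.comp contDiff_fst)))
    · exact ContDiffAt.comp (g := H) (f := fun q : (ℝ × Phase n) × ℝ => q.1.2) _ hH (by fun_prop)
  have hG0 : G ((s₀, γ s₀), 0) = 0 := by simp [G]
  have hpart : fderiv ℝ G ((s₀, γ s₀), 0) (0, 1) = inner ℝ ν ν := by
    have h1 : HasDerivAt (fun c : ℝ => (((s₀, γ s₀), c) : (ℝ × Phase n) × ℝ)) (0, 1) 0 :=
      (hasDerivAt_const _ _).prodMk (hasDerivAt_id _)
    have h2 := ((hG.differentiableAt one_ne_zero).hasFDerivAt).comp_hasDerivAt (0 : ℝ) h1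
    have h3 : HasDerivAt (fun c : ℝ => γ s₀ + c • ν) ν 0 := by
      simpa using ((hasDerivAt_id (0 : ℝ)).smul_const ν).const_add (γ s₀)
    have h4 : HasFDerivAt H (fderiv ℝ H (γ s₀)) (γ s₀ + (0 : ℝ) • ν) := by
      simpa using S.H_hasFDerivAt (hγ.mem s₀)
    have h5 := (HasFDerivAt.comp_hasDerivAt (l := H) (0 : ℝ) h4 h3).sub_const (H (γ s₀))
    rw [fderiv_apply_eq_inner_gradient] at h5
    exact h2.unique h5
  have hne : ν ≠ 0 := fun h => hDH (ContinuousLinearMap.ext fun x => by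
    rw [fderiv_apply_eq_inner_gradient, ← hν, h, inner_zero_left]; rfl)
  have hinv : (fderiv ℝ G ((s₀, γ s₀), 0) ∘L .inr ℝ (ℝ × Phase n) ℝ).IsInvertible :=
    isInvertible_comp_inr_of_ne_zero (by rw [hpart]; exact inner_self_ne_zero.2 hne)
  have hloc := hG.eventually_apply_eq_iff_implicitFunction one_ne_zero hinv
  rw [hG0] at hloc
  -- The derivative of G in the step c is ‖ν‖² ≠ 0 at the base point. Since c = 0 is always a zero
  -- of G, local uniqueness makes it the only one.
  have ht : Tendsto (fun q : (ℝ × Phase n) × ℝ => (q.1, (0 : ℝ))) (𝓝 ((s₀, γ s₀), 0))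
      (𝓝 ((s₀, γ s₀), 0)) := Continuous.tendsto' (by fun_prop) _ _ rfl
  filter_upwards [hloc, ht.eventually hloc] with q h1 h2 h3
  exact (h1.1 (sub_eq_zero.2 h3)).symm.trans (h2.1 (by simp [G]))

/-- The augmented displacement problem for the unknowns `(ξ, T, μ)` with parameters `(s, ε)`. -/
noncomputable def _root_.augmentedDisplacement (X : Set (Phase n)) (f : Phase n → Phase n)
    (H : Phase n → ℝ) (g : Phase n → ℝ → ℝ → ℝ → Phase n) (γ : ℝ → Phase n) (l : ℝ)
    (L : Phase n × ℝ → ℝ) (lam : ℝ) (q : (ℝ × ℝ) × (Phase n × ℝ × ℝ)) : Phase n × ℝ × ℝ :=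
  (trajectory X f g (l * q.2.2.1) q.2.1 q.2.2.1 q.1.2 - q.2.1 -
      q.2.2.2 • gradient H (γ q.1.1),
    L (q.2.1, l * q.2.2.1) - lam, inner ℝ (q.2.1 - γ q.1.1) (f (γ q.1.1)))

theorem contDiffAt_augmentedDisplacement (S : IsRegularSystem X f H g εmax k)
    (hγ : IsPeriodicOrbit X f γ τ) {l T₀ : ℝ} (hl : 0 < l) (hT₀ : 0 < T₀)
    {L : Phase n × ℝ → ℝ} {s : ℝ} (hLd : ContDiffAt ℝ k L (γ s, l * T₀)) (lam : ℝ) :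
    ContDiffAt ℝ k (augmentedDisplacement X f H g γ l L lam) ((s, 0), (γ s, T₀, 0)) := by
  have hγk := hγ.contDiff S.f_contDiffOn
  have hfk : ContDiff ℝ k (fun s => f (γ s)) := S.f_contDiffOn.comp_contDiff hγk hγ.mem
  have hνk := S.contDiff_gradient_orbit hγ
  have hs1 : ContDiff ℝ k (fun q : (ℝ × ℝ) × (Phase n × ℝ × ℝ) => q.1.1) := by fun_prop
  refine ContDiffAt.prodMk ?_ (ContDiffAt.prodMk ?_ ?_)
  · refine ContDiffAt.sub (ContDiffAt.sub ?_ (by fun_prop)) ?_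
    · exact ContDiffAt.comp
        (g := fun w : Phase n × ℝ × ℝ => trajectory X f g (l * w.2.1) w.1 w.2.1 w.2.2)
        (f := fun q : (ℝ × ℝ) × (Phase n × ℝ × ℝ) => (q.2.1, q.2.2.1, q.1.2)) _
        (S.endpoint_properties hγ hl hT₀ s).2.1 (by fun_prop)
    · exact ContDiffAt.smul (f := fun q : (ℝ × ℝ) × (Phase n × ℝ × ℝ) => q.2.2.2)
        (by fun_prop) (hνk.comp hs1).contDiffAt
  · refine ContDiffAt.sub ?_ contDiffAt_const
    exact ContDiffAt.comp (g := L)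
      (f := fun q : (ℝ × ℝ) × (Phase n × ℝ × ℝ) => (q.2.1, l * q.2.2.1)) _ hLd (by fun_prop)
  · exact ContDiffAt.inner ℝ
      (ContDiffAt.sub (f := fun q : (ℝ × ℝ) × (Phase n × ℝ × ℝ) => q.2.1) (by fun_prop)
        (hγk.comp hs1).contDiffAt) (hfk.comp hs1).contDiffAt

theorem fderiv_augmentedDisplacement (S : IsRegularSystem X f H g εmax k)
    (hγ : IsPeriodicOrbit X f γ τ) {l T₀ : ℝ} (hl : 0 < l) (hT₀ : 0 < T₀)
    {L : Phase n × ℝ → ℝ} {s : ℝ} (hLd : ContDiffAt ℝ k L (γ s, l * T₀)) (lam : ℝ)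
    (η : Phase n) (c μ : ℝ) :
    fderiv ℝ (augmentedDisplacement X f H g γ l L lam) ((s, 0), (γ s, T₀, 0)) (0, (η, c, μ)) =
      (fderiv ℝ (fun w : Phase n × ℝ × ℝ => trajectory X f g (l * w.2.1) w.1 w.2.1 w.2.2)
        (γ s, T₀, 0) (η, c, 0) - η - μ • gradient H (γ s),
        fderiv ℝ L (γ s, l * T₀) (η, l * c), inner ℝ η (f (γ s))) := by
  set P := fun w : Phase n × ℝ × ℝ => trajectory X f g (l * w.2.1) w.1 w.2.1 w.2.2 with hPdef
  have hK := ((S.contDiffAt_augmentedDisplacement hγ hl hT₀ hLd lam).differentiableAt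
    S.cast_ne_zero).hasFDerivAt
  have hlin : ∀ a b : ℝ, HasDerivAt (fun r : ℝ => a + r * b) b 0 := fun a b => by
    simpa using ((hasDerivAt_id (0 : ℝ)).mul_const b).const_add a
  have hlinv : HasDerivAt (fun r : ℝ => γ s + r • η) η 0 := by
    simpa using ((hasDerivAt_id (0 : ℝ)).smul_const η).const_add (γ s)
  have hcurve : HasDerivAt (fun r : ℝ => (((s, 0), (γ s + r • η, T₀ + r * c, 0 + r * μ)) :
      (ℝ × ℝ) × (Phase n × ℝ × ℝ))) (0, (η, c, μ)) 0 :=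
    (hasDerivAt_const _ _).prodMk (hlinv.prodMk ((hlin _ _).prodMk (hlin _ _)))
  have hbase : (((s, 0), (γ s, T₀, 0)) : (ℝ × ℝ) × (Phase n × ℝ × ℝ)) =
      ((s, 0), (γ s + (0 : ℝ) • η, T₀ + 0 * c, 0 + 0 * μ)) := by simp
  have h1 := hK.comp_hasDerivAt_of_eq (0 : ℝ) hcurve hbase
  have hPd : HasFDerivAt P (fderiv ℝ P (γ s, T₀, 0)) (γ s, T₀, 0) :=
    ((S.endpoint_properties hγ hl hT₀ s).2.1.differentiableAt S.cast_ne_zero).hasFDerivAt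
  have h2 : HasDerivAt (fun r : ℝ => P (γ s + r • η, T₀ + r * c, 0))
      (fderiv ℝ P (γ s, T₀, 0) (η, c, 0)) 0 :=
    hPd.comp_hasDerivAt_of_eq (0 : ℝ)
      (hlinv.prodMk ((hlin _ _).prodMk (hasDerivAt_const _ _))) (by simp)
  have hLd' := (hLd.differentiableAt S.cast_ne_zero).hasFDerivAt
  have h3 : HasDerivAt (fun r : ℝ => L (γ s + r • η, l * (T₀ + r * c)))
      (fderiv ℝ L (γ s, l * T₀) (η, l * c)) 0 :=
    hLd'.comp_hasDerivAt_of_eq (0 : ℝ) (hlinv.prodMk ((hlin _ _).const_mul l)) (by simp)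
  have h4 : HasDerivAt (fun r : ℝ => inner ℝ (γ s + r • η - γ s) (f (γ s)))
      (inner ℝ η (f (γ s))) 0 := by
    simpa using (hlinv.sub_const (γ s)).inner ℝ (hasDerivAt_const (0 : ℝ) (f (γ s)))
  have h5 := ((h2.sub hlinv).sub ((hlin 0 μ).smul_const (gradient H (γ s)))).prodMk
    ((h3.sub_const lam).prodMk h4)
  exact h1.unique h5

/-- The Lyapunov–Schmidt reduction near an unperturbed periodic orbit: the unknowns `(ξ, T, μ)` of
the augmented displacement problem as functions of `(s, ε)`, and the work of the perturbation as
bifurcation function. -/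
theorem exists_reduction (S : IsRegularSystem X f H g εmax k)
    (hγ : IsPeriodicOrbit X f γ τ) {l T₀ : ℝ} {m : ℕ} (hl : 0 < l) (hT₀ : 0 < T₀)
    (hlT : l * T₀ = m * τ) (hm : 0 < m) (hDH : fderiv ℝ H (γ 0) ≠ 0) (hnormal : IsMNormal f γ τ m)
    {L : Phase n × ℝ → ℝ} (hLd : ∀ t, ContDiffAt ℝ k L (γ t, m * τ))
    (hL : ParametrisesFamily X f γ τ m L) :
    ∃ (Ψ : ℝ × ℝ → Phase n × ℝ × ℝ) (ρ ε₁ : ℝ), 0 < ρ ∧ 0 < ε₁ ∧ ε₁ ≤ εmax ∧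
      (∀ s ε, |ε| < ε₁ → ContDiffAt ℝ k Ψ (s, ε) ∧
        ContDiffAt ℝ k (fun q : ℝ × ℝ =>
          work X f H g (l * (Ψ q).2.1) (Ψ q).1 (Ψ q).2.1 q.2) (s, ε) ∧
        Ψ (s + τ, ε) = Ψ (s, ε)) ∧
      (∀ s, Ψ (s, 0) = (γ s, T₀, 0)) ∧
      (∀ s ε, |ε| < ε₁ → ‖(Ψ (s, ε)).1 - γ s‖ < ρ ∧
        inner ℝ ((Ψ (s, ε)).1 - γ s) (f (γ s)) = 0) ∧
      (∀ s ε, 0 < |ε| → |ε| < ε₁ →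
        work X f H g (l * (Ψ (s, ε)).2.1) (Ψ (s, ε)).1 (Ψ (s, ε)).2.1 ε = 0 →
        0 < (Ψ (s, ε)).2.1 ∧
        (∃ x, IsTrajectory X f g (Ψ (s, ε)).1 (Ψ (s, ε)).2.1 ε (l * (Ψ (s, ε)).2.1) x) ∧
        trajectory X f g (l * (Ψ (s, ε)).2.1) (Ψ (s, ε)).1 (Ψ (s, ε)).2.1 ε = (Ψ (s, ε)).1 ∧
        L ((Ψ (s, ε)).1, l * (Ψ (s, ε)).2.1) = L (γ 0, m * τ)) ∧
      (∀ s ε ξ T, 0 < |ε| → |ε| < ε₁ → ‖ξ - γ s‖ < ρ → |T - T₀| < ρ →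
        (∃ x, IsTrajectory X f g ξ T ε (l * T) x) → trajectory X f g (l * T) ξ T ε = ξ →
        L (ξ, l * T) = L (γ 0, m * τ) → inner ℝ (ξ - γ s) (f (γ s)) = 0 →
        Ψ (s, ε) = (ξ, T, 0) ∧ work X f H g (l * T) ξ T ε = 0) ∧
      ∀ s s' ξ, ‖ξ - γ s‖ < ρ → ‖ξ - γ s'‖ < ρ → inner ℝ (ξ - γ s) (f (γ s)) = 0 →
        inner ℝ (ξ - γ s') (f (γ s')) = 0 → ∃ j : ℤ, s' = s + j * τ := by
  have hpart := S.partial_injective hγ hl hT₀ hlT hm hDH hnormal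
    (fun t => (hLd t).differentiableAt S.cast_ne_zero) hL
  have hτ := hγ.period_pos
  let h : Phase n × ℝ × ℝ → ℝ := fun w => work X f H g (l * w.2.1) w.1 w.2.1 w.2.2
  have hend := S.endpoint_properties hγ hl hT₀
  have hLγ : ∀ s, L (γ s, m * τ) = L (γ 0, m * τ) := fun s => by
    obtain ⟨u, p, hu0, hp0, -, -, hfam⟩ := hL
    have := hfam.self_of_nhds.2 s
    rwa [hu0, hp0] at this
  let y₀ : ℝ → Phase n × ℝ × ℝ := fun s => (γ s, T₀, 0)
  have hy₀ : Continuous y₀ := hγ.continuous.prodMk continuous_const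
  have hy₀p : ∀ s, y₀ (s + τ) = y₀ s := fun s => by simp only [y₀, hγ.periodic]
  let K := augmentedDisplacement X f H g γ l L (L (γ 0, m * τ))
  have hKp : ∀ s ε y, K ((s + τ, ε), y) = K ((s, ε), y) := fun s ε y => by
    simp only [K, augmentedDisplacement, hγ.periodic]
  have hLd' : ∀ s, ContDiffAt ℝ k L (γ s, l * T₀) := fun s => by rw [hlT]; exact hLd s
  have hKc : ∀ s, ContDiffAt ℝ k K ((s, 0), y₀ s) := fun s =>
    S.contDiffAt_augmentedDisplacement hγ hl hT₀ (hLd' s) _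
  have hK0 : ∀ s, K ((s, 0), y₀ s) = 0 := fun s => by
    have h1 : trajectory X f g (l * T₀) (γ s) T₀ 0 = γ s := by
      rw [S.trajectory_periodicOrbit hγ hT₀ (mul_pos hl hT₀).le, hlT, hγ.periodic_nat]
    simp only [K, y₀, augmentedDisplacement]
    rw [h1, hlT, hLγ]
    simp
  have hKinj : ∀ s v, fderiv ℝ K ((s, 0), y₀ s) (0, v) = 0 → v = 0 := by
    rintro s ⟨η, c, μ⟩ hv
    have h6 : _ = (0 : Phase n × ℝ × ℝ) :=
      (S.fderiv_augmentedDisplacement hγ hl hT₀ (hLd' s) _ η c μ).symm.trans hv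
    rw [hlT] at h6
    obtain ⟨rfl, rfl, rfl⟩ := (hpart s).2 η c μ (congrArg (fun v => v.1) h6)
      (congrArg (fun v => v.2.1) h6) (congrArg (fun v => v.2.2) h6)
    rfl
  -- One radius for all that the balance argument needs: existence of the trajectory (`trajectory`
  -- has a default value otherwise), smoothness of the work, and injectivity of H along the
  -- gradient.
  obtain ⟨ρ₁, hρ₁, hgood⟩ := exists_uniform_nhds_curve hτ hy₀ hy₀p
    (R := fun s ε y => (0 < y.2.1 ∧ |ε| < εmax ∧
        ∃ x, IsTrajectory X f g y.1 y.2.1 ε (l * y.2.1) x) ∧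
      ContDiffAt ℝ k h (y.1, y.2.1, ε) ∧
      (H (y.1 + y.2.2 • gradient H (γ s)) = H y.1 → y.2.2 = 0))
    (fun s ε y => by simp only [hγ.periodic]) fun s₀ => by
      have ht1 : Tendsto (fun q : (ℝ × ℝ) × (Phase n × ℝ × ℝ) => (q.2.1, q.2.2.1, q.1.2))
          (𝓝 ((s₀, 0), y₀ s₀)) (𝓝 (γ s₀, T₀, 0)) := Continuous.tendsto' (by fun_prop) _ _ rfl
      have ht2 : Tendsto (fun q : (ℝ × ℝ) × (Phase n × ℝ × ℝ) => ((q.1.1, q.2.1), q.2.2.2))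
          (𝓝 ((s₀, 0), y₀ s₀)) (𝓝 ((s₀, γ s₀), 0)) := Continuous.tendsto' (by fun_prop) _ _ rfl
      have ht3 : Tendsto (fun q : (ℝ × ℝ) × (Phase n × ℝ × ℝ) => q.2.2.1)
          (𝓝 ((s₀, 0), y₀ s₀)) (𝓝 T₀) := Continuous.tendsto' (by fun_prop) _ _ rfl
      have ht4 : Tendsto (fun q : (ℝ × ℝ) × (Phase n × ℝ × ℝ) => |q.1.2|)
          (𝓝 ((s₀, 0), y₀ s₀)) (𝓝 |0|) := Continuous.tendsto' (by fun_prop) _ _ rfl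
      filter_upwards [ht1.eventually (hend s₀).1,
        ht1.eventually ((hend s₀).2.2.eventually (by simp)),
        ht2.eventually (S.eventually_H_add_gradient hγ (hpart s₀).1),
        ht3.eventually (eventually_gt_nhds hT₀),
        ht4.eventually (eventually_lt_nhds S.abs_zero_lt)] with q h1 h2 h3 h4 h5
      exact ⟨⟨h4, h5, h1⟩, h2, h3⟩
  obtain ⟨ρ₂, hρ₂, hfoot⟩ := S.exists_uniform_foot hγ
  obtain ⟨Ψ, ρ, ε₂, hρ, hρle, hε₂, hΨ, huniq⟩ := exists_periodic_implicitFunction hτ S.ne_zero hy₀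
    hy₀p hKp hKc hK0 hKinj (lt_min hρ₁ hρ₂)
  have hρ1 : ρ ≤ ρ₁ := hρle.trans (min_le_left _ _)
  have hρ2 : ρ ≤ ρ₂ := hρle.trans (min_le_right _ _)
  have hgoodΨ := fun s ε (hε : |ε| < min εmax (min ε₂ ρ₁)) =>
    hgood s ε (Ψ (s, ε)) (hε.trans_le ((min_le_right _ _).trans (min_le_right _ _)))
      ((hΨ s ε (hε.trans_le ((min_le_right _ _).trans (min_le_left _ _)))).2.2.1.trans_le hρ1)
  refine ⟨Ψ, ρ, min εmax (min ε₂ ρ₁), hρ, lt_min S.pos (lt_min hε₂ hρ₁), min_le_left _ _, ?_, ?_,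
    ?_, ?_, ?_, ?_⟩
  · intro s ε hε
    obtain ⟨h1, -, -, h4⟩ := hΨ s ε (hε.trans_le ((min_le_right _ _).trans (min_le_left _ _)))
    refine ⟨h1, ?_, h4⟩
    exact ContDiffAt.comp (g := h) (f := fun q : ℝ × ℝ => ((Ψ q).1, (Ψ q).2.1, q.2)) (s, ε)
      (hgoodΨ s ε hε).2.1 (h1.fst.prodMk (h1.snd.fst.prodMk contDiffAt_snd))
  · intro s
    exact (huniq s 0 (y₀ s) (by simpa using hε₂) (by simpa using hρ) (hK0 s)).symm
  · intro s ε hε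
    obtain ⟨-, h2, h3, -⟩ := hΨ s ε (hε.trans_le ((min_le_right _ _).trans (min_le_left _ _)))
    exact ⟨(norm_fst_le (Ψ (s, ε) - y₀ s)).trans_lt h3, congrArg (fun v => v.2.2) h2⟩
  · intro s ε hε0 hε hB
    obtain ⟨-, h2, -, -⟩ := hΨ s ε (hε.trans_le ((min_le_right _ _).trans (min_le_left _ _)))
    obtain ⟨⟨hT, hεm, hex⟩, -, hμ⟩ := hgoodΨ s ε hε
    have h3 : trajectory X f g (l * (Ψ (s, ε)).2.1) (Ψ (s, ε)).1 (Ψ (s, ε)).2.1 ε =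
        (Ψ (s, ε)).1 + (Ψ (s, ε)).2.2 • gradient H (γ s) := by
      have h4 : trajectory X f g (l * (Ψ (s, ε)).2.1) (Ψ (s, ε)).1 (Ψ (s, ε)).2.1 ε -
        (Ψ (s, ε)).1 - (Ψ (s, ε)).2.2 • gradient H (γ s) = 0 := congrArg (fun v => v.1) h2
      rwa [sub_sub, sub_eq_zero] at h4
    have h5 := S.H_trajectory hT hεm (mul_pos hl hT).le hex
    -- Zero work means that H agrees at ξ and at ξ + μ∇H(γ s), hence μ = 0 and the trajectory closes
    -- up.
    rw [hB, mul_zero, sub_eq_zero, h3] at h5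
    refine ⟨hT, hex, ?_, sub_eq_zero.1 (congrArg (fun v => v.2.1) h2)⟩
    rw [h3, hμ h5, zero_smul, add_zero]
  · intro s ε ξ T hε0 hε hξ hT hex hP hLξ hin
    -- A genuine solution with foot s solves the augmented problem with μ = 0, so it is Ψ(s, ε); its
    -- work vanishes because ε ≠ 0.
    have h1 : ‖((ξ, T, 0) : Phase n × ℝ × ℝ) - y₀ s‖ < ρ :=
      max_lt hξ (max_lt hT (by simpa [y₀] using hρ))
    obtain ⟨⟨hTpos, hεm, -⟩, -, -⟩ := hgood s ε (ξ, T, 0)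
      (hε.trans_le ((min_le_right _ _).trans (min_le_right _ _))) (h1.trans_le hρ1)
    refine ⟨(huniq s ε _ (hε.trans_le ((min_le_right _ _).trans (min_le_left _ _))) h1 ?_).symm, ?_⟩
    · simp only [K, augmentedDisplacement]
      rw [hP, hLξ, hin]
      simp
    · have h5 := S.H_trajectory hTpos hεm (mul_pos hl hTpos).le hex
      rw [hP, sub_self] at h5
      exact (mul_eq_zero.1 h5.symm).resolve_left (abs_pos.1 hε0)
  · exact fun s s' ξ h1 h2 => hfoot s s' ξ (h1.trans_le hρ2) (h2.trans_le hρ2)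

end IsRegularSystem

end Auxiliary

/-! ### Proof of the reduction theorem -/

theorem mainTheorem3 {n r m l : ℕ} (hr : 2 ≤ r) (hm : 0 < m) (hl : 0 < l)
    (hml : Nat.Coprime m l)
    (X : Set (Phase n)) (hX : IsOpen X)
    (f : Phase n → Phase n) (hf : ContDiffOn ℝ (r : WithTop ℕ∞) f X)
    (H : Phase n → ℝ) (hH : ContDiffOn ℝ (r : WithTop ℕ∞) H X)
    (hHf : ∀ x ∈ X, fderiv ℝ H x (f x) = 0)
    (εmax : ℝ) (hεmax : 0 < εmax)
    (g : Phase n → ℝ → ℝ → ℝ → Phase n) (hg : IsPerturbation X εmax r g)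
    (γ : ℝ → Phase n) (τ : ℝ) (hγ : IsPeriodicOrbit X f γ τ)
    (hDH : fderiv ℝ H (γ 0) ≠ 0)
    (hnormal : IsMNormal f γ τ m)
    (L : Phase n × ℝ → ℝ)
    (hLsmooth : ∀ t : ℝ, ContDiffAt ℝ (r : WithTop ℕ∞) L (γ t, m * τ))
    (hL : ParametrisesFamily X f γ τ m L) :
    ∃ (B : ℝ → ℝ → ℝ) (Ξ : ℝ → ℝ → Phase n) (Θ : ℝ → ℝ → ℝ) (ε₁ C₀ : ℝ),
      0 < ε₁ ∧ ε₁ ≤ εmax ∧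
      ContDiffOn ℝ ((r - 1 : ℕ) : WithTop ℕ∞) (fun q : ℝ × ℝ => B q.1 q.2)
        (Set.univ ×ˢ Set.Ioo (-ε₁) ε₁) ∧
      ContDiffOn ℝ ((r - 1 : ℕ) : WithTop ℕ∞) (fun q : ℝ × ℝ => Ξ q.1 q.2)
        (Set.univ ×ˢ Set.Ioo (-ε₁) ε₁) ∧
      ContDiffOn ℝ ((r - 1 : ℕ) : WithTop ℕ∞) (fun q : ℝ × ℝ => Θ q.1 q.2)
        (Set.univ ×ˢ Set.Ioo (-ε₁) ε₁) ∧
      (∀ s ε : ℝ, |ε| < ε₁ →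
        B (s + τ) ε = B s ε ∧ Ξ (s + τ) ε = Ξ s ε ∧ Θ (s + τ) ε = Θ s ε) ∧
      (∀ s ε : ℝ, |ε| < ε₁ →
        |B s ε - melnikov H g γ τ m l s| ≤ C₀ * |ε| ∧
        ‖Ξ s ε - γ s‖ ≤ C₀ * |ε| ∧ |Θ s ε - τ * m / l| ≤ C₀ * |ε|) ∧
      (∀ C : ℝ, C₀ ≤ C → ∃ ε₀ : ℝ, 0 < ε₀ ∧ ε₀ ≤ ε₁ ∧
        ∀ ε : ℝ, 0 < |ε| → |ε| < ε₀ →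
          Set.BijOn (fun s => (Ξ s ε, Θ s ε))
            {s : ℝ | s ∈ Set.Ico 0 τ ∧ B s ε = 0}
            (closeSolutions X f g γ τ m l L C ε)) := by
  -- k = r - 1 is the regularity shared by DH and by g jointly in all its arguments, time included.
  obtain ⟨k, rfl⟩ : ∃ k, r = k + 1 := ⟨r - 1, by omega⟩
  have hk0 : k ≠ 0 := by omega
  rw [Nat.add_sub_cancel]
  have hkr : (k : WithTop ℕ∞) ≤ ((k + 1 : ℕ) : WithTop ℕ∞) := by
    exact_mod_cast Nat.le_succ k
  have S : IsRegularSystem X f H g εmax k :=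
    ⟨hX, hk0, hεmax, hf.of_le hkr, hH, hHf, by simpa using hg.contDiffOn_joint⟩
  have hlpos : (0 : ℝ) < l := by exact_mod_cast hl
  have hmpos : (0 : ℝ) < m := by exact_mod_cast hm
  have hτ := hγ.period_pos
  have hT₀ : 0 < τ * m / l := by positivity
  have hlT : (l : ℝ) * (τ * m / l) = m * τ := by
    field_simp
  obtain ⟨Ψ, ρ, ε₂, hρ, hε₂, hε₂m, hsm, hzero, hnear, hsol, huniq, hfoot⟩ :=
    S.exists_reduction hγ hlpos hT₀ hlT hm hDH hnormal (fun t => (hLsmooth t).of_le hkr) hL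
  set T₀ := τ * m / l with hT₀def
  let B : ℝ × ℝ → ℝ := fun q => work X f H g (l * (Ψ q).2.1) (Ψ q).1 (Ψ q).2.1 q.2
  have hBp : ∀ s ε, |ε| < ε₂ → B (s + τ, ε) = B (s, ε) := fun s ε hε => by
    simp only [B, (hsm s ε hε).2.2]
  have hB0 : ∀ s, B (s, 0) = melnikov H g γ τ m l s := fun s => by
    simp only [B, hzero]
    rw [S.work_eq hT₀ S.abs_zero_lt (mul_pos hlpos hT₀).le (hγ.isTrajectory g s T₀ _), hlT]
    simp only [melnikov, add_comm s, ← hT₀def]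
  have h0lt : |(0 : ℝ)| < ε₂ := by simpa using hε₂
  -- B and Ψ are bounded together, so one constant C₀ = ρB⁻¹ serves for all three estimates.
  obtain ⟨ρB, hρB, hbound⟩ := exists_uniform_linear_bound hτ (F := fun q => (B q, Ψ q))
    (fun s => ((hsm s 0 h0lt).2.1.prodMk (hsm s 0 h0lt).1).of_le S.one_le)
    ⟨ε₂, hε₂, fun s ε hε => by rw [hBp s ε hε, (hsm s ε hε).2.2]⟩
  have hC₀ : 0 < ρB⁻¹ := inv_pos.2 hρB
  have hbd : ∀ s ε, |ε| < min ε₂ ρB → |B (s, ε) - melnikov H g γ τ m l s| ≤ ρB⁻¹ * |ε| ∧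
      ‖(Ψ (s, ε)).1 - γ s‖ ≤ ρB⁻¹ * |ε| ∧ |(Ψ (s, ε)).2.1 - T₀| ≤ ρB⁻¹ * |ε| := by
    intro s ε hε
    have h1 := hbound s ε (hε.trans_le (min_le_right _ _))
    rw [hB0, hzero] at h1
    have h2 := (norm_snd_le _).trans h1
    exact ⟨(norm_fst_le _).trans h1, (norm_fst_le _).trans h2,
      (norm_fst_le _).trans ((norm_snd_le _).trans h2)⟩
  refine ⟨fun s ε => B (s, ε), fun s ε => (Ψ (s, ε)).1, fun s ε => (Ψ (s, ε)).2.1, min ε₂ ρB,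
    ρB⁻¹, lt_min hε₂ hρB, (min_le_left _ _).trans hε₂m, ?_, ?_, ?_, ?_, hbd, ?_⟩
  · exact fun q hq => (hsm q.1 q.2 ((abs_lt.2 hq.2).trans_le (min_le_left _ _))).2.1.contDiffWithinAt
  · exact fun q hq =>
      (hsm q.1 q.2 ((abs_lt.2 hq.2).trans_le (min_le_left _ _))).1.fst.contDiffWithinAt
  · exact fun q hq =>
      (hsm q.1 q.2 ((abs_lt.2 hq.2).trans_le (min_le_left _ _))).1.snd.fst.contDiffWithinAt
  · intro s ε hε
    have hε' := hε.trans_le (min_le_left _ _)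
    exact ⟨hBp s ε hε', congrArg (fun v => v.1) (hsm s ε hε').2.2,
      congrArg (fun v => v.2.1) (hsm s ε hε').2.2⟩
  intro C hC
  have hCpos : 0 < C := hC₀.trans_le hC
  -- The bound ρ/C makes C|ε| < ρ, so that every close solution lies in the uniqueness
  -- neighbourhood.
  refine ⟨min (min ε₂ ρB) (ρ / C), lt_min (lt_min hε₂ hρB) (by positivity), min_le_left _ _,
    fun ε hε0 hε => ?_⟩
  have hε₁ := hε.trans_le (min_le_left _ _)
  have hε₂' := hε₁.trans_le (min_le_left _ _)
  have hCε : C * |ε| < ρ := by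
    have := hε.trans_le (min_le_right _ _)
    rwa [lt_div_iff₀ hCpos, mul_comm] at this
  have hC' : ρB⁻¹ * |ε| ≤ C * |ε| := mul_le_mul_of_nonneg_right hC (abs_nonneg _)
  refine ⟨?_, ?_, ?_⟩
  · rintro s ⟨-, hBs⟩
    obtain ⟨h1, h2, h3, h4⟩ := hsol s ε hε0 hε₂' hBs
    obtain ⟨-, h5, h6⟩ := hbd s ε hε₁
    refine ⟨⟨h1, h2⟩, ?_, ⟨s, h5.trans hC'⟩, h6.trans hC'⟩
    exact Prod.ext (sub_eq_zero.2 h3) (sub_eq_zero.2 h4)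
  -- Equal ξ means that s and s' are both feet of ξ, so they differ by a multiple of τ, and in [0,
  -- τ) they coincide.
  · rintro s ⟨hs, -⟩ s' ⟨hs', -⟩ he
    have he1 : (Ψ (s, ε)).1 = (Ψ (s', ε)).1 := (Prod.ext_iff.1 he).1
    obtain ⟨h1, h2⟩ := hnear s ε hε₂'
    obtain ⟨h3, h4⟩ := hnear s' ε hε₂'
    rw [← he1] at h3 h4
    obtain ⟨j, hj⟩ := hfoot s s' _ h1 h3 h2 h4
    have hj1 : (j : ℝ) < 1 := by
      have : (j : ℝ) * τ < 1 * τ := by linarith [hs.1, hs'.2]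
      exact lt_of_mul_lt_mul_right this hτ.le
    have hj2 : (-1 : ℝ) < j := by
      have : (-1 : ℝ) * τ < j * τ := by linarith [hs.2, hs'.1]
      exact lt_of_mul_lt_mul_right this hτ.le
    have hj0 : j = 0 := by
      have h5 : j < 1 := by exact_mod_cast hj1
      have h6 : -1 < j := by exact_mod_cast hj2
      omega
    rw [hj, hj0]
    simp
  · rintro ⟨ξ, T⟩ ⟨⟨hTpos, hex⟩, hΔ, ⟨s₀, hs₀⟩, hT⟩
    have hper : Function.Periodic γ τ := hγ.periodic
    -- The preimage of (ξ, T) is the parameter of a nearest orbit point, where the squared distance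
    -- is stationary; this is the phase condition.
    obtain ⟨s₁, -, hmin⟩ := isCompact_Icc.exists_isMinOn (Set.nonempty_Icc.2 hτ.le)
      (f := fun t => ‖ξ - γ t‖) (continuous_const.sub hγ.continuous).norm.continuousOn
    obtain ⟨s, hs, hs₁⟩ := hper.exists_mem_Ico₀ hτ s₁
    have hmin' : ∀ t, ‖ξ - γ s‖ ≤ ‖ξ - γ t‖ := fun t => by
      obtain ⟨t', ht', he⟩ := hper.exists_mem_Ico₀ hτ t
      rw [he, ← hs₁]
      exact hmin (Set.Ico_subset_Icc_self ht')
    have hin : inner ℝ (ξ - γ s) (f (γ s)) = 0 := by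
      have hd := ((hγ.hasDerivAt s).const_sub ξ).norm_sq
      have hloc : IsLocalMin (fun t => ‖ξ - γ t‖ ^ 2) s :=
        Filter.Eventually.of_forall fun t => pow_le_pow_left₀ (norm_nonneg _) (hmin' t) 2
      have := hloc.hasDerivAt_eq_zero hd
      rw [inner_neg_right] at this
      linarith
    obtain ⟨hP, hLξ⟩ := Prod.ext_iff.1 hΔ
    obtain ⟨hΨ, hw⟩ := huniq s ε ξ T hε0 hε₂' ((hmin' s₀).trans_lt (hs₀.trans_lt hCε))
      (hT.trans_lt hCε) hex (sub_eq_zero.1 hP) (sub_eq_zero.1 hLξ) hin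
    refine ⟨s, ⟨hs, ?_⟩, ?_⟩
    · simpa only [B, hΨ] using hw
    · simp only [hΨ]
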